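/- Let $K/k$ be a finite Galois extension with group $G=\operatorname{Gal}(K/k)$, let $g_1,\dots,g_m$ generate $G$, and let $\varphi\colon G\to \mathrm{GL}(n,\mathbb Z)$ be a group homomorphism (for example the inclusion, when $G$ is a subgroup of $\mathrm{GL}(n,\mathbb Z)$). Let ${}_\varphi\mathcal T(K)$ be the $G$-module $(K^\times)^n$ with the action $$g\cdot(x_1,\dots,x_n)=\Bigl(\prod_{i} g(x_i)^{a_{1i}},\dots,\prod_{i} g(x_i)^{a_{ni}}\Bigr),\qquad \varphi(g)=(a_{ji}).$$ Let $N\le G$ be a subgroup and let $\mathcal U$ be an $N$-integer, that is, the abelian group $\mathbb Z$ with an action of $N$ by group automorphisms; put $I=\{h\in N : h\cdot 1=1 \text{ in } \mathcal U\}$. For an $N$-module $M$ let $\operatorname{Ind}_N^G(M)=\mathbb Z G\otimes_{\mathbb Z N}M$ with $g\cdot(x\otimes y)=gx\otimes y$, and for $g\in G$ let $T_g(N,\mathcal U)$ be the operator $x\otimes y\mapsto gx\otimes y$ on $\operatorname{Ind}_N^G(\mathcal U)$. Suppose that $\{\varphi(g_i)\}_{i}$ is simultaneously similar to $\{T_{g_i}(N,\mathcal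 U)\}_{i}$: there are an ordered $\mathbb Z$-basis $S$ of $\operatorname{Ind}_N^G(\mathcal U)$ with $n$ elements and a matrix $T\in\mathrm{GL}(n,\mathbb Z)$ such that, for every $i=1,\dots,m$, $T^{-1}\varphi(g_i)T$ is the matrix of $T_{g_i}(N,\mathcal U)$ in the basis $S$. Then: 1. ${}_\varphi\mathcal T(K)\cong \operatorname{Ind}_N^G(\mathcal U\otimes_{\mathbb Z}K^\times)$ as $G$-modules, where $N$ acts on $\mathcal U\otimes_{\mathbb Z} K^\times$ diagonally. 2. $H^1(G,{}_\varphi\mathcal T(K))\cong \operatorname{Br}(K^N|K^I)$ as groups, where $K^N\subseteq K^I$ are the fixed fields of $N$ and $I$, and $\operatorname{Br}(F|E)$ denotes the group of Brauer classes of central simple $F$-algebras that split over $E$. -/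

import Mathlib

open scoped TensorProduct

namespace TorusForms

section TensorSimple

variable {F A B : Type*} [Field F] [Ring A] [Ring B] [Algebra F A] [Algebra F B]

/-- For a central simple `A`, every linear endomorphism of `A` is a sum of maps
`x ↦ a * x * b`. -/
theorem mulLeftRight_surjective [Algebra.IsCentral F A] [IsSimpleRing A]
    [FiniteDimensional F A] : Function.Surjective (AlgHom.mulLeftRight F A) := by
  let _ : Module (A ⊗[F] Aᵐᵒᵖ) A := TensorProduct.Algebra.module
  have hsmul : ∀ (x : A ⊗[F] Aᵐᵒᵖ) (a : A), x • a = AlgHom.mulLeftRight F A x a :=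
    fun _ _ => rfl
  have hsimple : IsSimpleModule (A ⊗[F] Aᵐᵒᵖ) A := by
    rw [isSimpleModule_iff_toSpanSingleton_surjective]
    refine ⟨inferInstance, fun m hm a => ?_⟩
    let I : TwoSidedIdeal A := TwoSidedIdeal.mk' {x | ∃ t : A ⊗[F] Aᵐᵒᵖ, AlgHom.mulLeftRight F A t m = x}
      ⟨0, by simp⟩
      (by rintro _ _ ⟨s, rfl⟩ ⟨t, rfl⟩; exact ⟨s + t, by simp⟩)
      (by rintro _ ⟨s, rfl⟩; exact ⟨-s, by simp⟩)
      (by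
        rintro x _ ⟨s, rfl⟩
        refine ⟨(x ⊗ₜ 1) * s, ?_⟩
        simp)
      (by
        rintro _ y ⟨s, rfl⟩
        refine ⟨(1 ⊗ₜ MulOpposite.op y) * s, ?_⟩
        simp)
    have hmI : m ∈ I := by
      simp only [I, TwoSidedIdeal.mem_mk']
      exact ⟨1, by simp⟩
    have h1 : (1 : A) ∈ I := IsSimpleRing.one_mem_of_ne_zero_mem I hm hmI
    have ha : a ∈ I := by simpa using I.mul_mem_left a 1 h1
    simp only [I, TwoSidedIdeal.mem_mk'] at ha
    exact ha
  intro f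
  have hend : ∀ φ : Module.End (A ⊗[F] Aᵐᵒᵖ) A, ∃ c : F, ∀ x, φ x = c • x := by
    intro φ
    have hl : ∀ a x, φ (a * x) = a * φ x := fun a x => by
      have := φ.map_smul (a ⊗ₜ 1) x
      rw [hsmul, hsmul] at this
      simpa using this
    have hr : ∀ b x, φ (x * b) = φ x * b := fun b x => by
      have := φ.map_smul (1 ⊗ₜ MulOpposite.op b) x
      rw [hsmul, hsmul] at this
      simpa using this
    have hc : φ 1 ∈ Subalgebra.center F A := by
      rw [Subalgebra.mem_center_iff]
      intro b
      rw [← hl, ← hr, mul_one, one_mul]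
    rw [Algebra.IsCentral.center_eq_bot, Algebra.mem_bot] at hc
    obtain ⟨c, hc⟩ := hc
    refine ⟨c, fun x => ?_⟩
    have := hr x 1
    rw [one_mul] at this
    rw [this, ← hc, Algebra.smul_def]
  let f' : Module.End (Module.End (A ⊗[F] Aᵐᵒᵖ) A) A :=
    { toFun := f
      map_add' := f.map_add
      map_smul' := by
        intro φ x
        obtain ⟨c, hc⟩ := hend φ
        simp [hc] }
  obtain ⟨s, hs⟩ := Module.Finite.fg_top (R := F) (M := A)
  obtain ⟨r, hr⟩ := jacobson_density (R := A ⊗[F] Aᵐᵒᵖ) f' s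
  refine ⟨r, ?_⟩
  refine LinearMap.ext_on hs fun m hm => ?_
  exact (hr m hm).symm

theorem exists_bimultiplication [Algebra.IsCentral F A] [IsSimpleRing A]
    [FiniteDimensional F A] (f : A →ₗ[F] A) :
    ∃ (n : ℕ) (l r : Fin n → A), ∀ x, f x = ∑ i, l i * x * r i := by
  obtain ⟨t, ht⟩ := mulLeftRight_surjective (F := F) (A := A) f
  obtain ⟨S, rfl⟩ := TensorProduct.exists_finset t
  let e := S.equivFin
  refine ⟨S.card, fun i => (e.symm i).1.1, fun i => (e.symm i).1.2.unop, fun x => ?_⟩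
  rw [← ht, map_sum, LinearMap.sum_apply, ← Finset.sum_coe_sort, ← e.symm.sum_comp]
  simp

theorem rTensor_eq_sum (f : A →ₗ[F] A) {n : ℕ} {l r : Fin n → A}
    (h : ∀ x, f x = ∑ i, l i * x * r i) (z : A ⊗[F] B) :
    f.rTensor B z = ∑ i, (l i ⊗ₜ 1) * z * (r i ⊗ₜ 1) := by
  induction z using TensorProduct.induction_on with
  | zero => simp
  | tmul a b => simp [h, TensorProduct.sum_tmul]
  | add x y hx hy => simp [hx, hy, mul_add, add_mul, Finset.sum_add_distrib]

instance isSimpleRing_tensorProduct [Algebra.IsCentral F A] [IsSimpleRing A]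
    [FiniteDimensional F A] [IsSimpleRing B] : IsSimpleRing (A ⊗[F] B) := by
  have : Nontrivial (A ⊗[F] B) := inferInstance
  refine ⟨⟨fun I => ?_⟩⟩
  rw [or_iff_not_imp_left]
  intro hI
  obtain ⟨z, hzI, hz⟩ : ∃ z ∈ I, z ≠ 0 := by
    by_contra! hcon
    exact hI (le_bot_iff.mp fun x hx => by simpa using hcon x hx)
  let b := Module.finBasis F A
  have hkey : ∃ y : B, y ≠ 0 ∧ (1 : A) ⊗ₜ[F] y ∈ I := by
    obtain ⟨c, hc⟩ : ∃ c : Fin (Module.finrank F A) → B, z = ∑ i, b i ⊗ₜ c i := by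
      clear hzI hz
      induction z using TensorProduct.induction_on with
      | zero => exact ⟨0, by simp⟩
      | tmul a y =>
        refine ⟨fun i => b.repr a i • y, ?_⟩
        conv_lhs => rw [← b.sum_repr a]
        rw [TensorProduct.sum_tmul]
        simp_rw [TensorProduct.smul_tmul]
      | add x y hx hy =>
        obtain ⟨c, rfl⟩ := hx
        obtain ⟨d, rfl⟩ := hy
        exact ⟨c + d, by simp [TensorProduct.tmul_add, Finset.sum_add_distrib]⟩
    obtain ⟨j, hj⟩ : ∃ j, c j ≠ 0 := by
      by_contra! hcon
      exact hz (by simp [hc, hcon])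
    refine ⟨c j, hj, ?_⟩
    let f : A →ₗ[F] A := (LinearMap.toSpanSingleton F A 1) ∘ₗ b.coord j
    obtain ⟨n, l, r, hf⟩ := exists_bimultiplication f
    have h1 := rTensor_eq_sum (B := B) f hf z
    have h2 : f.rTensor B z = 1 ⊗ₜ c j := by
      rw [hc, map_sum, Finset.sum_eq_single j]
      · simp [f]
      · intro i _ hij
        simp [f, Finsupp.single_eq_of_ne hij.symm]
      · simp
    rw [← h2, h1]
    exact sum_mem fun i _ => I.mul_mem_right _ _ (I.mul_mem_left _ _ hzI)
  obtain ⟨y, hy, hyI⟩ := hkey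
  let J : TwoSidedIdeal B := I.comap (Algebra.TensorProduct.includeRight : B →ₐ[F] A ⊗[F] B)
  have hyJ : y ∈ J := by simpa [J, TwoSidedIdeal.mem_comap] using hyI
  have h1 : (1 : B) ∈ J := IsSimpleRing.one_mem_of_ne_zero_mem J hy hyJ
  have h1' : (1 : A ⊗[F] B) ∈ I := by
    have := (TwoSidedIdeal.mem_comap _).mp h1
    rwa [map_one] at this
  exact (TwoSidedIdeal.one_mem_iff I).mp h1'

instance isCentral_tensorProduct [Algebra.IsCentral F A] [IsSimpleRing A]
    [FiniteDimensional F A] [Algebra.IsCentral F B] [Nontrivial B] :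
    Algebra.IsCentral F (A ⊗[F] B) := by
  refine ⟨fun z hz => ?_⟩
  rw [Subalgebra.mem_center_iff] at hz
  obtain ⟨lam, hlam⟩ : ∃ lam : A →ₗ[F] F, lam 1 = 1 := by
    obtain ⟨lam, h⟩ := (LinearMap.toSpanSingleton F A 1).exists_leftInverse_of_injective
      (LinearMap.ker_toSpanSingleton F (one_ne_zero : (1 : A) ≠ 0))
    exact ⟨lam, by simpa using LinearMap.congr_fun h 1⟩
  let f : A →ₗ[F] A := (LinearMap.toSpanSingleton F A 1) ∘ₗ lam
  obtain ⟨n, l, r, hf⟩ := exists_bimultiplication f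
  have hz1 : f.rTensor B z = z := by
    have hsum : ∑ i, l i * r i = 1 := by simpa [f, hlam] using (hf 1).symm
    rw [rTensor_eq_sum (B := B) f hf z]
    calc ∑ i, (l i ⊗ₜ[F] (1 : B)) * z * (r i ⊗ₜ 1)
        = ∑ i, ((l i * r i) ⊗ₜ[F] (1 : B)) * z := by
          refine Finset.sum_congr rfl fun i _ => ?_
          rw [mul_assoc, ← hz (r i ⊗ₜ 1), ← mul_assoc]; simp
      _ = z := by rw [← Finset.sum_mul, ← TensorProduct.sum_tmul, hsum]; exact one_mul z
  have hmem : ∀ w : A ⊗[F] B, ∃ y : B, f.rTensor B w = 1 ⊗ₜ y := by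
    intro w
    induction w using TensorProduct.induction_on with
    | zero => exact ⟨0, by simp⟩
    | tmul a y => exact ⟨lam a • y, by simp [f, TensorProduct.smul_tmul]⟩
    | add x y hx hy =>
      obtain ⟨c, hc⟩ := hx
      obtain ⟨d, hd⟩ := hy
      exact ⟨c + d, by rw [map_add, hc, hd, TensorProduct.tmul_add]⟩
  obtain ⟨y, hy⟩ := hmem z
  rw [hz1] at hy
  subst hy
  have hinj : Function.Injective (Algebra.TensorProduct.includeRight : B →ₐ[F] A ⊗[F] B) :=
    Algebra.TensorProduct.includeRight_injective (FaithfulSMul.algebraMap_injective F A)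
  have hyc : y ∈ Subalgebra.center F B := by
    rw [Subalgebra.mem_center_iff]
    intro w
    apply hinj
    simpa using hz (1 ⊗ₜ w)
  rw [Algebra.IsCentral.center_eq_bot, Algebra.mem_bot] at hyc
  obtain ⟨c, rfl⟩ := hyc
  rw [Algebra.mem_bot]
  exact ⟨c, by rw [Algebra.TensorProduct.algebraMap_apply, Algebra.algebraMap_eq_smul_one,
    Algebra.algebraMap_eq_smul_one, TensorProduct.smul_tmul]⟩

end TensorSimple

section Brauer

universe u v

variable {F : Type u} [Field F]

open Algebra.TensorProduct

/-- A `1 × 1` matrix is its entry. -/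
def matrixFinOneEquiv (R S : Type*) [CommSemiring R] [Semiring S] [Algebra R S] :
    Matrix (Fin 1) (Fin 1) S ≃ₐ[R] S where
  toFun M := M 0 0
  invFun s := Matrix.of fun _ _ => s
  left_inv M := by ext i j; rw [Subsingleton.elim i 0, Subsingleton.elim j 0]; rfl
  right_inv _ := rfl
  map_mul' M N := by simp [Matrix.mul_apply]
  map_add' _ _ := rfl
  commutes' r := by simp [Matrix.algebraMap_matrix_apply]

/-- The tensor product of two central simple algebras. -/
noncomputable def tensorCSA (A B : CSA.{u, u} F) : CSA.{u, u} F where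
  __ := AlgCat.of F (A ⊗[F] B)
  isCentral := inferInstanceAs (Algebra.IsCentral F (A ⊗[F] B))
  isSimple := inferInstanceAs (IsSimpleRing (A ⊗[F] B))
  fin_dim := inferInstanceAs (FiniteDimensional F (A ⊗[F] B))

/-- The opposite of a central simple algebra. -/
def opCSA (A : CSA.{u, u} F) : CSA.{u, u} F where
  __ := AlgCat.of F Aᵐᵒᵖ
  isCentral := inferInstanceAs (Algebra.IsCentral F Aᵐᵒᵖ)
  isSimple := inferInstanceAs (IsSimpleRing Aᵐᵒᵖ)
  fin_dim := inferInstanceAs (FiniteDimensional F Aᵐᵒᵖ)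

variable (F) in
/-- The base field as a central simple algebra over itself. -/
def oneCSA : CSA.{u, u} F where
  __ := AlgCat.of F F
  isCentral := inferInstanceAs (Algebra.IsCentral F F)
  isSimple := inferInstanceAs (IsSimpleRing F)
  fin_dim := inferInstanceAs (FiniteDimensional F F)

theorem brauerEquivalent_of_algEquiv {A B : CSA.{u, u} F} (e : A ≃ₐ[F] B) :
    IsBrauerEquivalent A B :=
  ⟨1, 1, one_ne_zero, one_ne_zero, ⟨e.mapMatrix⟩⟩

theorem tensorCSA_congr {A A' B B' : CSA.{u, u} F} (h : IsBrauerEquivalent A A')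
    (h' : IsBrauerEquivalent B B') :
    IsBrauerEquivalent (tensorCSA A B) (tensorCSA A' B') := by
  obtain ⟨n, m, hn, hm, ⟨e⟩⟩ := h
  obtain ⟨p, q, hp, hq, ⟨e'⟩⟩ := h'
  refine ⟨n * p, m * q, mul_ne_zero hn hp, mul_ne_zero hm hq, ⟨?_⟩⟩
  exact ((Matrix.reindexAlgEquiv F (A ⊗[F] B) finProdFinEquiv).symm.trans
    (Matrix.kroneckerTMulAlgEquiv (Fin n) (Fin p) F F A B).symm).trans
    ((congr e e').trans ((Matrix.kroneckerTMulAlgEquiv (Fin m) (Fin q) F F A' B').trans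
      (Matrix.reindexAlgEquiv F (A' ⊗[F] B') finProdFinEquiv)))

theorem opCSA_congr {A A' : CSA.{u, u} F} (h : IsBrauerEquivalent A A') :
    IsBrauerEquivalent (opCSA A) (opCSA A') := by
  obtain ⟨n, m, hn, hm, ⟨e⟩⟩ := h
  exact ⟨n, m, hn, hm, ⟨(AlgEquiv.mopMatrix (R := F) (α := A) (m := Fin n)).trans
    (e.op.trans (AlgEquiv.mopMatrix (R := F) (α := A') (m := Fin m)).symm)⟩⟩

theorem tensorCSA_op (A : CSA.{u, u} F) :
    IsBrauerEquivalent (tensorCSA (opCSA A) A) (oneCSA F) := by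
  have hfin : Module.finrank F A ≠ 0 := Module.finrank_pos.ne'
  have hbij : Function.Bijective (AlgHom.mulLeftRight F A).toLinearMap := by
    have hs : Function.Surjective (AlgHom.mulLeftRight F A).toLinearMap :=
      mulLeftRight_surjective
    refine ⟨(LinearMap.injective_iff_surjective_of_finrank_eq_finrank ?_).mpr hs, hs⟩
    rw [Module.finrank_tensorProduct, Module.finrank_linearMap,
      (MulOpposite.opLinearEquiv F (M := A)).finrank_eq]
  let e1 : Aᵐᵒᵖ ⊗[F] A ≃ₐ[F] A ⊗[F] Aᵐᵒᵖ := Algebra.TensorProduct.comm F Aᵐᵒᵖ A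
  let e2 : A ⊗[F] Aᵐᵒᵖ ≃ₐ[F] Module.End F A := AlgEquiv.ofBijective _ hbij
  let e3 : Module.End F A ≃ₐ[F] Matrix (Fin (Module.finrank F A)) (Fin (Module.finrank F A)) F :=
    algEquivMatrix (Module.finBasis F A)
  let e4 : Matrix (Fin 1) (Fin 1) (Aᵐᵒᵖ ⊗[F] A) ≃ₐ[F] Aᵐᵒᵖ ⊗[F] A :=
    matrixFinOneEquiv F _
  exact ⟨1, Module.finrank F A, one_ne_zero, hfin, ⟨e4.trans (e1.trans (e2.trans e3))⟩⟩

/-- The Brauer group, with the multiplication `[A][B] = [A ⊗ B]`, the unit `[F]` and the inverse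
`[A]⁻¹ = [Aᵐᵒᵖ]`. -/
noncomputable instance instCommGroupBrauerGroup : CommGroup (BrauerGroup.{u, u} F) where
  mul := Quotient.map₂ tensorCSA fun _ _ h _ _ h' => tensorCSA_congr h h'
  one := ⟦oneCSA F⟧
  inv := Quotient.map opCSA fun _ _ h => opCSA_congr h
  mul_assoc := by
    rintro ⟨A⟩ ⟨B⟩ ⟨C⟩
    exact Quotient.sound (brauerEquivalent_of_algEquiv
      (Algebra.TensorProduct.assoc F F F A B C))
  one_mul := by
    rintro ⟨A⟩
    exact Quotient.sound (brauerEquivalent_of_algEquiv (Algebra.TensorProduct.lid F A))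
  mul_one := by
    rintro ⟨A⟩
    exact Quotient.sound (brauerEquivalent_of_algEquiv (Algebra.TensorProduct.rid F F A))
  inv_mul_cancel := by
    rintro ⟨A⟩
    exact Quotient.sound (tensorCSA_op A)
  mul_comm := by
    rintro ⟨A⟩ ⟨B⟩
    exact Quotient.sound (brauerEquivalent_of_algEquiv (Algebra.TensorProduct.comm F A B))

/-- `A` splits over the extension `E` of `F` if `E ⊗ A` is a matrix algebra over `E`. -/
def SplitsOver (E : Type v) [Field E] [Algebra F E] (A : CSA.{u, u} F) : Prop :=
  ∃ n : ℕ, Nonempty (E ⊗[F] A ≃ₐ[E] Matrix (Fin n) (Fin n) E)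

variable (F) in
/-- The relative Brauer group `Br(F|E)`: Brauer classes of central simple `F`-algebras that
split over `E`, with the multiplication induced by the tensor product. -/
def relBrauerGroup (E : Type v) [Field E] [Algebra F E] : Subgroup (BrauerGroup.{u, u} F) where
  carrier := {x | ∃ A : CSA.{u, u} F, ⟦A⟧ = x ∧ SplitsOver E A}
  one_mem' := ⟨oneCSA F, rfl, 1, ⟨(Algebra.TensorProduct.rid F E E).trans
    (matrixFinOneEquiv E E).symm⟩⟩
  mul_mem' := by
    rintro _ _ ⟨A, rfl, n, ⟨e⟩⟩ ⟨B, rfl, m, ⟨e'⟩⟩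
    refine ⟨tensorCSA A B, rfl, n * m, ⟨?_⟩⟩
    let e1 : E ⊗[F] (A ⊗[F] B) ≃ₐ[E] (E ⊗[F] A) ⊗[F] B :=
      (Algebra.TensorProduct.assoc F F E E A B).symm
    let e2 : (E ⊗[F] A) ⊗[F] B ≃ₐ[E] Matrix (Fin n) (Fin n) E ⊗[F] B :=
      congr e AlgEquiv.refl
    let e3 : Matrix (Fin n) (Fin n) E ⊗[F] B ≃ₐ[E] Matrix (Fin n) (Fin n) (E ⊗[F] B) :=
      (congr AlgEquiv.refl (matrixFinOneEquiv F B).symm).trans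
        ((Matrix.kroneckerTMulAlgEquiv (Fin n) (Fin 1) F E E B).trans
          (Matrix.reindexAlgEquiv E (E ⊗[F] B) (Equiv.prodUnique (Fin n) (Fin 1))))
    let e4 : Matrix (Fin n) (Fin n) (E ⊗[F] B) ≃ₐ[E]
      Matrix (Fin n) (Fin n) (Matrix (Fin m) (Fin m) E) := e'.mapMatrix
    exact e1.trans (e2.trans (e3.trans (e4.trans ((Matrix.compAlgEquiv _ _ _ _).trans
      (Matrix.reindexAlgEquiv E E finProdFinEquiv)))))
  inv_mem' := by
    rintro _ ⟨A, rfl, n, ⟨e⟩⟩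
    refine ⟨opCSA A, rfl, n, ⟨?_⟩⟩
    let e1 : E ⊗[F] Aᵐᵒᵖ ≃ₐ[E] Eᵐᵒᵖ ⊗[F] Aᵐᵒᵖ := congr (AlgEquiv.toOpposite E E) AlgEquiv.refl
    let e2 : Eᵐᵒᵖ ⊗[F] Aᵐᵒᵖ ≃ₐ[E] (E ⊗[F] A)ᵐᵒᵖ := opAlgEquiv F E E A
    exact e1.trans (e2.trans (e.op.trans (Matrix.transposeAlgEquiv (Fin n) E E).symm))

end Brauer
section Cohomology

variable {R G V : Type*} [CommRing R] [Group G] [AddCommGroup V] [Module R V]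

/-- The group of 1-cocycles `c : G → V`, written additively: `c (g h) = c g + g · c h`. -/
def cocycles1 (ρ : Representation R G V) : AddSubgroup (G → V) where
  carrier := {c | ∀ g h, c (g * h) = c g + ρ g (c h)}
  zero_mem' := fun _ _ => by simp
  add_mem' := fun {a b} ha hb g h => by
    simp only [Pi.add_apply, ha g h, hb g h, map_add]
    abel
  neg_mem' := fun {a} ha g h => by
    simp only [Pi.neg_apply, ha g h, map_neg]
    abel

/-- The 1-coboundary `g ↦ g · a - a` of an element `a`. -/
def coboundary1 (ρ : Representation R G V) : V →+ (G → V) where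
  toFun a := fun g => ρ g a - a
  map_zero' := by ext; simp
  map_add' a b := by
    ext g
    simp only [Pi.add_apply, map_add]
    abel

/-- The first cohomology group `H¹(G, V)`: 1-cocycles modulo 1-coboundaries. -/
abbrev H1 (ρ : Representation R G V) : Type _ :=
  cocycles1 ρ ⧸ (coboundary1 ρ).range.addSubgroupOf (cocycles1 ρ)

end Cohomology

section GaloisModules

variable {k K : Type*} [Field k] [Field K] [Algebra k K]

/-- The multiplicative group `Kˣ`, written additively, as a module over the Galois group. -/
noncomputable def unitsRep (k K : Type*) [Field k] [Field K] [Algebra k K] :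
    Representation ℤ (K ≃ₐ[k] K) (Additive Kˣ) :=
  Representation.ofMulDistribMulAction (K ≃ₐ[k] K) Kˣ

/-- The action of an integral matrix on `(Kˣ)ⁿ`: the `j`-th coordinate of `A * (x₁, …, xₙ)` is
the product of the `xᵢ ^ A j i`. -/
def matrixAct {n : ℕ} (A : Matrix (Fin n) (Fin n) ℤ) (x : Fin n → Kˣ) : Fin n → Kˣ :=
  fun j => ∏ i, x i ^ A j i

theorem matrixAct_one {n : ℕ} (x : Fin n → Kˣ) : matrixAct 1 x = x := by
  ext j
  simp [matrixAct, Matrix.one_apply, Finset.prod_ite_eq]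

theorem matrixAct_mul {n : ℕ} (A B : Matrix (Fin n) (Fin n) ℤ) (x : Fin n → Kˣ) :
    matrixAct (A * B) x = matrixAct A (matrixAct B x) := by
  funext j
  simp only [matrixAct, Matrix.mul_apply, ← Finset.prod_zpow, ← zpow_mul]
  rw [Finset.prod_comm]
  refine Finset.prod_congr rfl fun i _ => ?_
  have hsum : ∀ (s : Finset (Fin n)) (e : Fin n → ℤ), x i ^ ∑ l ∈ s, e l = ∏ l ∈ s, x i ^ e l :=
    fun s e => map_sum (zpowersHom Kˣ (x i)).toAdditiveRight e s
  rw [hsum]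
  exact Finset.prod_congr rfl fun l _ => by rw [mul_comm]

theorem smul_matrixAct {n : ℕ} (g : K ≃ₐ[k] K) (A : Matrix (Fin n) (Fin n) ℤ) (x : Fin n → Kˣ) :
    g • matrixAct A x = matrixAct A (g • x) := by
  funext j
  simp [matrixAct, Finset.smul_prod', smul_zpow']

/-- The Galois module of `K`-points of the torus attached to `φ`: it is `(Kˣ)ⁿ`, written
additively, and the `j`-th coordinate of `g · (x₁, …, xₙ)` is the product of the
`g(xᵢ) ^ φ(g) j i`. -/
noncomputable def torusRep {n : ℕ} (φ : (K ≃ₐ[k] K) →* GL (Fin n) ℤ) :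
    Representation ℤ (K ≃ₐ[k] K) (Additive (Fin n → Kˣ)) where
  toFun g := (AddMonoidHom.mk' (fun x : Additive (Fin n → Kˣ) => Additive.ofMul
    (matrixAct (φ g : Matrix (Fin n) (Fin n) ℤ) (g • x.toMul))) fun x y => by
      refine Additive.toMul.injective (funext fun j => ?_)
      simp [matrixAct, mul_zpow, Finset.prod_mul_distrib]).toIntLinearMap
  map_one' := by
    refine LinearMap.ext fun x => ?_
    simp [matrixAct_one]
  map_mul' g h := by
    refine LinearMap.ext fun x => ?_
    simp [matrixAct_mul, smul_matrixAct, mul_smul]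

theorem torusRep_apply {n : ℕ} (φ : (K ≃ₐ[k] K) →* GL (Fin n) ℤ) (g : K ≃ₐ[k] K)
    (x : Fin n → Kˣ) (j : Fin n) :
    (((torusRep φ g (Additive.ofMul x)).toMul j : Kˣ) : K) =
      ∏ i, g (x i : K) ^ ((φ g : Matrix (Fin n) (Fin n) ℤ) j i) := by
  simp [torusRep, matrixAct]

/-- For an action of a group `H` on the abelian group `ℤ` (an `H`-integer), the canonical
subgroup is the subgroup of all elements that fix `1`. -/
def canonicalSubgroup {H : Type*} [Group H] (U : Representation ℤ H ℤ) : Subgroup H where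
  carrier := {h | U h 1 = 1}
  one_mem' := by simp
  mul_mem' := by
    intro a b ha hb
    simp only [Set.mem_ofPred_eq] at ha hb ⊢
    rw [map_mul, Module.End.mul_apply, hb, ha]
  inv_mem' := by
    intro a ha
    simp only [Set.mem_ofPred_eq] at ha ⊢
    conv_lhs => rw [← ha]
    exact U.inv_self_apply a 1

/-- The operator `T_g(N, U)` on the induced module `Ind_N^G(U)`, `x ⊗ y ↦ g x ⊗ y`. In the model
`Representation.IndV` of the induced module, `x ⊗ y` is the class of `x⁻¹ ⊗ₜ y`. -/
noncomputable def indOperator {R G V : Type*} [CommRing R] [Group G] [AddCommGroup V] [Module R V]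
    (N : Subgroup G) (U : Representation R N V) (g : G) :
    Representation.IndV N.subtype U →ₗ[R] Representation.IndV N.subtype U :=
  Representation.ind N.subtype U g

theorem indOperator_mk {R G V : Type*} [CommRing R] [Group G] [AddCommGroup V] [Module R V]
    (N : Subgroup G) (U : Representation R N V) (g x : G) (y : V) :
    indOperator N U g (Representation.IndV.mk N.subtype U x⁻¹ y) =
      Representation.IndV.mk N.subtype U (g * x)⁻¹ y := by
  rw [indOperator, Representation.ind_mk, mul_inv_rev]

/-- In the induced module, `x h ⊗ y = x ⊗ h y` for `h ∈ N`. -/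
theorem indV_mk_mul {R G V : Type*} [CommRing R] [Group G] [AddCommGroup V] [Module R V]
    (N : Subgroup G) (U : Representation R N V) (x : G) (h : N) (y : V) :
    Representation.IndV.mk N.subtype U (x * h)⁻¹ y =
      Representation.IndV.mk N.subtype U x⁻¹ (U h y) := by
  have := (Representation.Coinvariants.mk_self_apply
    (Representation.tprod ((Representation.leftRegular R G).comp N.subtype) U) h
    (MonoidAlgebra.single ((x * h)⁻¹) 1 ⊗ₜ y)).symm
  simpa using this

/-- The `N`-module `U ⊗ Kˣ` with the diagonal action. -/
noncomputable def tensorUnitsRep (N : Subgroup (K ≃ₐ[k] K)) (U : Representation ℤ N ℤ) :=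
  Representation.tprod U ((unitsRep k K).comp N.subtype)

/-- Simultaneous similarity over `ℤ` of two families of integral matrices. -/
def SimultaneouslySimilar {ι : Type*} {n : ℕ} (A B : ι → Matrix (Fin n) (Fin n) ℤ) : Prop :=
  ∃ T : GL (Fin n) ℤ, ∀ i,
    ((T⁻¹ : GL (Fin n) ℤ) : Matrix (Fin n) (Fin n) ℤ) * A i * (T : Matrix (Fin n) (Fin n) ℤ) = B i

/-- Simultaneous similarity of a family of `n × n` matrices to a family of linear operators on a
free `ℤ`-module of rank `n`, the operators being read as matrices in an ordered basis. -/
def SimilarToOperators {ι V : Type*} [AddCommGroup V] [Module ℤ V] {n : ℕ}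
    (A : ι → Matrix (Fin n) (Fin n) ℤ) (T : ι → V →ₗ[ℤ] V) : Prop :=
  ∃ S : Module.Basis (Fin n) ℤ V, SimultaneouslySimilar A fun i => LinearMap.toMatrix S S (T i)

/-- For subgroups `I ≤ N` of the Galois group, the field `K^I` as an extension of `K^N`. -/
noncomputable def fixedFieldOver (N : Subgroup (K ≃ₐ[k] K)) (I : Subgroup N) :
    IntermediateField (IntermediateField.fixedField N) K :=
  IntermediateField.extendScalars (F := IntermediateField.fixedField N)
    (E := IntermediateField.fixedField (I.map N.subtype))
    (IntermediateField.fixedField_antitone (Subgroup.map_subtype_le I))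

end GaloisModules

end TorusForms

/-! Write F = K^N and E = K^I. The action on 𝒰 = ℤ is a sign character of N with kernel I.

The similarity, given on generators, holds on all of G because both sides are homomorphisms. After a
change of basis `φ g` is the matrix of `g` on Ind(𝒰), so the torus module is Ind(𝒰) ⊗ Kˣ
(`SimilarToOperators.nonempty_torusEquiv`), and the projection formula `indTensorEquiv` turns this
into Ind(𝒰 ⊗ Kˣ).

For H¹, finite index makes induction coinduction, and Shapiro's lemma (`H1CoindEquiv`) reduces to
H¹(N, 𝒰 ⊗ Kˣ), where 𝒰 ⊗ Kˣ is Kˣ with the action twisted by the sign. If I = N, Hilbert 90 kills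
H¹, and Br(F|E) is trivial because E = F. Otherwise E is quadratic over F with conjugation σ. By
Hilbert 90 on I, every class contains a cocycle that is trivial on I; it is constant off I with
value in Fˣ, and it is a coboundary exactly when that value is a norm from E. So H¹ ≅ Fˣ/N(Eˣ).

The group Br(F|E) is also Fˣ/N(Eˣ) (`relBrauerEquiv`). Over E an algebra A split by E becomes a
matrix algebra, and by Skolem–Noether σ acts on the image of A as conjugation by some P. Then P ·
σ(P) is a scalar in Fˣ, well defined modulo norms and multiplicative in A. If it is 1, Galois
descent makes A a matrix algebra over F; quaternion algebras realize every value. -/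

namespace TorusForms

/-! ### The norm-class invariant of an algebra split by a quadratic extension. -/

section Quadratic

open Module Matrix

universe u

variable {F E : Type u} [Field F] [Field E] [Algebra F E]

/-- `σ` is the nontrivial automorphism of a quadratic Galois extension `E` of `F`. -/
structure IsConjugation (σ : E →ₐ[F] E) : Prop where
  involutive : ∀ x, σ (σ x) = x
  fixed : ∀ x, σ x = x → ∃ a, algebraMap F E a = x
  exists_ne : ∃ x, σ x ≠ x

theorem nonempty_of_finrank_eq {A : Type u} [Ring A] [Algebra F A] [IsSimpleRing A]
    [FiniteDimensional F A] {ι : Type*} [Fintype ι] (h : finrank F A = Fintype.card ι ^ 2) :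
    Nonempty ι := by
  by_contra h0
  rw [not_nonempty_iff] at h0
  have : finrank F A ≠ 0 := Module.finrank_pos.ne'
  simp [h] at this

section BaseChange

variable {A : Type u} [Ring A] [Algebra F A] {ι : Type*} [Fintype ι] [DecidableEq ι]

/-- The `E`-linear extension of a representation of `A` by matrices over `E`. -/
noncomputable def baseChangeLift (f : A →ₐ[F] Matrix ι ι E) : E ⊗[F] A →ₐ[E] Matrix ι ι E :=
  Algebra.TensorProduct.lift (Algebra.ofId E (Matrix ι ι E)) f fun _ _ => Algebra.commutes _ _

theorem baseChangeLift_tmul (f : A →ₐ[F] Matrix ι ι E) (c : E) (x : A) :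
    baseChangeLift f (c ⊗ₜ x) = c • f x :=
  (Algebra.TensorProduct.lift_tmul _ _ _ _ _).trans (Algebra.smul_def _ _).symm

variable [Algebra.IsCentral F A] [IsSimpleRing A] [FiniteDimensional F A]

/-- Injective because the base change of a central simple algebra is simple; surjective because the
dimensions agree. -/
theorem baseChangeLift_bijective (f : A →ₐ[F] Matrix ι ι E)
    (h : finrank F A = Fintype.card ι ^ 2) : Function.Bijective (baseChangeLift f) := by
  have : Nonempty ι := nonempty_of_finrank_eq h
  have hinj : Function.Injective (baseChangeLift f) := by
    -- Simplicity is known with the central simple factor on the left, hence the swap.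
    let c : A ⊗[F] E ≃ₐ[F] E ⊗[F] A := Algebra.TensorProduct.comm F A E
    have h1 : Function.Injective ((baseChangeLift f).toRingHom.comp c.toRingEquiv.toRingHom) :=
      RingHom.injective _
    intro x y hxy
    have := @h1 (c.symm x) (c.symm y) (by simpa using hxy)
    simpa using this
  refine ⟨hinj, ?_⟩
  have := (LinearMap.injective_iff_surjective_of_finrank_eq_finrank
    (f := (baseChangeLift f).toLinearMap) ?_).mp hinj
  · exact this
  · rw [Module.finrank_baseChange, h, Module.finrank_matrix, Module.finrank_self]
    ring

/-- The image of `f` spans all matrices over `E`, so `C` is central. -/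
theorem exists_smul_one_of_commute (f : A →ₐ[F] Matrix ι ι E)
    (h : finrank F A = Fintype.card ι ^ 2) {C : Matrix ι ι E} (hC : ∀ x, C * f x = f x * C) :
    ∃ c : E, C = c • 1 := by
  have hall : ∀ X : Matrix ι ι E, C * X = X * C := fun X => by
    obtain ⟨z, rfl⟩ := (baseChangeLift_bijective f h).2 X
    induction z using TensorProduct.induction_on with
    | zero => simp
    | tmul c x => simp [baseChangeLift_tmul, hC]
    | add x y hx hy => rw [map_add, mul_add, hx, hy, add_mul]
  have : C ∈ Subalgebra.center E (Matrix ι ι E) := by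
    rw [Subalgebra.mem_center_iff]
    exact fun X => (hall X).symm
  have hne : Nonempty ι := nonempty_of_finrank_eq h
  rw [Algebra.IsCentral.center_eq_bot, Algebra.mem_bot] at this
  obtain ⟨c, rfl⟩ := this
  exact ⟨c, Algebra.algebraMap_eq_smul_one c⟩

/-- Two representations of `A` by matrices of the size of its degree are conjugate. -/
theorem exists_conj (f f' : A →ₐ[F] Matrix ι ι E) (h : finrank F A = Fintype.card ι ^ 2) :
    ∃ T T' : Matrix ι ι E, T * T' = 1 ∧ T' * T = 1 ∧ ∀ x, f' x * T = T * f x := by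
  let e := AlgEquiv.ofBijective _ (baseChangeLift_bijective f h)
  let e' := AlgEquiv.ofBijective _ (baseChangeLift_bijective f' h)
  let L : Matrix ι ι E ≃ₐ[E] End E (ι → E) := Matrix.toLinAlgEquiv'
  -- Skolem–Noether: comparing the two splittings of `E ⊗ A` gives an automorphism of a full
  -- endomorphism algebra, which is inner.
  obtain ⟨T, hT⟩ := (L.symm.trans ((e.symm.trans e').trans L)).eq_linearEquivConjAlgEquiv
  have key : ∀ x, L (f' x) * T.toLinearMap = T.toLinearMap * L (f x) := fun x => by
    have h1 : e.symm (f x) = 1 ⊗ₜ x := by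
      rw [AlgEquiv.symm_apply_eq]
      simp [e, baseChangeLift_tmul]
    have h2 : e' (1 ⊗ₜ x) = f' x := by simp [e', baseChangeLift_tmul]
    have := AlgEquiv.congr_fun hT (L (f x))
    simp only [AlgEquiv.trans_apply, AlgEquiv.symm_apply_apply, h1, h2] at this
    rw [this]
    refine LinearMap.ext fun v => ?_
    simp [LinearEquiv.conjAlgEquiv_apply]
  refine ⟨L.symm T.toLinearMap, L.symm T.symm.toLinearMap, ?_, ?_, fun x => L.injective ?_⟩
  · rw [← map_mul, ← map_one L.symm]
    congr 1
    refine LinearMap.ext fun v => ?_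
    simp
  · rw [← map_mul, ← map_one L.symm]
    congr 1
    refine LinearMap.ext fun v => ?_
    simp
  · simpa using key x

end BaseChange

theorem mapMatrix_smul' {ι : Type*} [Fintype ι] [DecidableEq ι] (σ : E →ₐ[F] E) (c : E)
    (X : Matrix ι ι E) : σ.mapMatrix (c • X) = σ c • σ.mapMatrix X := by
  ext i j
  simp

theorem IsConjugation.mapMatrix_mapMatrix {ι : Type*} [Fintype ι] [DecidableEq ι] {σ : E →ₐ[F] E}
    (hσ : IsConjugation σ) (X : Matrix ι ι E) : σ.mapMatrix (σ.mapMatrix X) = X := by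
  ext i j
  simp [hσ.involutive]

/-- `a` is the obstruction to descending the identification of `E ⊗ A` with a matrix algebra along
`σ`: under some representation of `A` by matrices of the size of its degree, `σ` acts on the image
of `A` as the conjugation by a matrix `P` with `P * σ P = a`. -/
def HasFactor (σ : E →ₐ[F] E) (A : Type u) [Ring A] [Algebra F A] (a : Fˣ) : Prop :=
  ∃ (n : ℕ) (f : A →ₐ[F] Matrix (Fin n) (Fin n) E) (P : Matrix (Fin n) (Fin n) E),
    finrank F A = n ^ 2 ∧ (∀ x, P * σ.mapMatrix (f x) = f x * P) ∧
      P * σ.mapMatrix P = algebraMap F E a • 1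

namespace HasFactor

variable {σ : E →ₐ[F] E} {A B : Type u} [Ring A] [Algebra F A] [Ring B] [Algebra F B] {a b : Fˣ}

/-- Allows product index types, which Kronecker products produce. -/
theorem of_fintype {ι : Type*} [Fintype ι] [DecidableEq ι] (f : A →ₐ[F] Matrix ι ι E)
    (P : Matrix ι ι E) (h : finrank F A = Fintype.card ι ^ 2)
    (hP : ∀ x, P * σ.mapMatrix (f x) = f x * P)
    (hPa : P * σ.mapMatrix P = algebraMap F E a • 1) : HasFactor σ A a := by
  let r := Matrix.reindexAlgEquiv F E (Fintype.equivFin ι)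
  have hr : ∀ X, σ.mapMatrix (r X) = r (σ.mapMatrix X) := fun X => rfl
  refine ⟨Fintype.card ι, r.toAlgHom.comp f, r P, h, fun x => ?_, ?_⟩
  · change r P * σ.mapMatrix (r (f x)) = r (f x) * r P
    rw [hr, ← map_mul, ← map_mul, hP]
  · rw [hr, ← map_mul, hPa, algebraMap_smul, map_smul, map_one, algebraMap_smul]

theorem congr (e : A ≃ₐ[F] B) (h : HasFactor σ A a) : HasFactor σ B a := by
  obtain ⟨n, f, P, hn, hP, hPa⟩ := h
  exact ⟨n, f.comp e.symm.toAlgHom, P, by rw [← e.toLinearEquiv.finrank_eq, hn],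
    fun x => hP _, hPa⟩

/-- The Kronecker product of `P` and `Q` serves for `A ⊗ B`, and its semilinear square is the
product of the two scalars. -/
theorem tensor (ha : HasFactor σ A a) (hb : HasFactor σ B b) :
    HasFactor σ (A ⊗[F] B) (a * b) := by
  obtain ⟨n, f, P, hn, hP, hPa⟩ := ha
  obtain ⟨m, g, Q, hm, hQ, hQb⟩ := hb
  let fg : A ⊗[F] B →ₐ[F] Matrix (Fin n × Fin m) (Fin n × Fin m) E :=
    ((Algebra.TensorProduct.lmul' F (S := E)).mapMatrix.comp
      (Matrix.kroneckerTMulAlgEquiv (Fin n) (Fin m) F F E E).toAlgHom).comp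
        (Algebra.TensorProduct.map f g)
  have hfg : ∀ x y, fg (x ⊗ₜ y) = kronecker (f x) (g y) := fun x y => by
    ext i j
    simp [fg]
  have hσ : ∀ (X : Matrix (Fin n) (Fin n) E) (Y : Matrix (Fin m) (Fin m) E),
      σ.mapMatrix (kronecker X Y) = kronecker (σ.mapMatrix X) (σ.mapMatrix Y) := fun X Y => by
    ext i j
    simp
  refine of_fintype fg (kronecker P Q) ?_ (fun z => ?_) ?_
  · rw [Module.finrank_tensorProduct, hn, hm]
    simp [mul_pow]
  · induction z using TensorProduct.induction_on with
    | zero => simp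
    | tmul x y =>
      rw [hfg, hσ]
      erw [← Matrix.mul_kronecker_mul, ← Matrix.mul_kronecker_mul, hP, hQ]
    | add x y hx hy => rw [map_add, map_add, mul_add, hx, hy, add_mul]
  · rw [hσ]
    erw [← Matrix.mul_kronecker_mul, hPa, hQb]
    ext ⟨i, j⟩ ⟨k, l⟩
    simp only [kronecker_apply, Matrix.smul_apply, one_apply, smul_eq_mul, Prod.mk.injEq,
      Units.val_mul, map_mul]
    split_ifs <;> simp_all
theorem matrix_base {n : ℕ} : HasFactor σ (Matrix (Fin n) (Fin n) F) 1 := by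
  refine ⟨n, (Algebra.ofId F E).mapMatrix, 1, ?_, fun x => ?_, ?_⟩
  · rw [Module.finrank_matrix]
    simp [sq]
  · ext i j
    simp [Algebra.ofId_apply]
  · simp

theorem matrix {n : ℕ} (h : HasFactor σ A a) : HasFactor σ (Matrix (Fin n) (Fin n) A) a := by
  have := (h.tensor (matrix_base (n := n))).congr (matrixEquivTensor (Fin n) F A).symm
  rwa [mul_one] at this

/-- Rescaling the matrix `P` changes the factor by a norm. -/
theorem mul_norm {c : Eˣ} {d : Fˣ} (hd : algebraMap F E d = c * σ c) (h : HasFactor σ A a) :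
    HasFactor σ A (d * a) := by
  obtain ⟨n, f, P, hn, hP, hPa⟩ := h
  refine ⟨n, f, (c : E) • P, hn, fun x => ?_, ?_⟩
  · rw [smul_mul_assoc, hP, mul_smul_comm]
  · rw [mapMatrix_smul', smul_mul_smul_comm, hPa, smul_smul, ← hd, Units.val_mul, map_mul]

variable [Algebra.IsCentral F A] [IsSimpleRing A] [FiniteDimensional F A]

/-- Skolem–Noether for `f` and its `σ`-conjugate gives `P`. Since `σ` is an involution, `P * σ P`
commutes with the image of `f`, so it is a scalar. -/
theorem exists_of_split (hσ : IsConjugation σ) {n : ℕ}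
    (e : E ⊗[F] A ≃ₐ[E] Matrix (Fin n) (Fin n) E) : ∃ a : Fˣ, HasFactor σ A a := by
  let f : A →ₐ[F] Matrix (Fin n) (Fin n) E :=
    (e.toAlgHom.restrictScalars F).comp Algebra.TensorProduct.includeRight
  have hn : finrank F A = Fintype.card (Fin n) ^ 2 := by
    rw [← Module.finrank_baseChange (R := E), e.toLinearEquiv.finrank_eq, Module.finrank_matrix,
      Module.finrank_self]
    ring
  have hne := nonempty_of_finrank_eq hn
  obtain ⟨P, P', hPP, hPP', hP⟩ := exists_conj (σ.mapMatrix.comp f) f hn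
  replace hP : ∀ x, P * σ.mapMatrix (f x) = f x * P := fun x => (hP x).symm
  obtain ⟨c, hc⟩ := exists_smul_one_of_commute f hn
    (C := P * σ.mapMatrix P) fun x => by
      rw [mul_assoc, ← mul_assoc (f x), ← hP, mul_assoc, ← map_mul, ← hP, map_mul,
        hσ.mapMatrix_mapMatrix]
  have hc' : σ.mapMatrix P * P = σ c • 1 := by
    have := congrArg σ.mapMatrix hc
    rwa [map_mul, hσ.mapMatrix_mapMatrix, mapMatrix_smul', map_one] at this
  have hPu : P ≠ 0 := by
    rintro rfl
    simp at hPP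
  -- Associativity: `(P * σ P) * P = P * (σ P * P)` reads `c • P = σ c • P`.
  have hcc : σ c = c := by
    have h1 : c • P = σ c • P := by
      rw [← one_mul P, ← smul_mul_assoc, ← hc, one_mul, mul_assoc, hc',
        mul_smul_comm, mul_one]
    exact (smul_left_injective E hPu h1).symm
  obtain ⟨a, rfl⟩ := hσ.fixed c hcc
  have ha : a ≠ 0 := by
    rintro rfl
    rw [map_zero, zero_smul] at hc
    apply hPu
    have h1 : σ.mapMatrix P = 0 := by
      rw [← one_mul (σ.mapMatrix P), ← hPP', mul_assoc, hc, mul_zero]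
    rw [← hσ.mapMatrix_mapMatrix P, h1, map_zero]
  exact ⟨Units.mk0 a ha, n, f, P, by simpa using hn, hP, hc⟩

theorem splits (h : HasFactor σ A a) :
    ∃ n : ℕ, Nonempty (E ⊗[F] A ≃ₐ[E] Matrix (Fin n) (Fin n) E) := by
  obtain ⟨n, f, -, hn, -, -⟩ := h
  exact ⟨n, ⟨AlgEquiv.ofBijective _ (baseChangeLift_bijective f (by simpa using hn))⟩⟩

/-- Conjugating `g` to `f` by `T` replaces `Q` by `R = T⁻¹ * Q * σ T` and keeps its scalar `b`. Then
`R * P⁻¹` commutes with the image of `f`, so `R = c • P`, and the two scalars differ by the norm of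
`c`. -/
theorem eq_norm_mul (hσ : IsConjugation σ) (ha : HasFactor σ A a) (hb : HasFactor σ A b) :
    ∃ c : Eˣ, algebraMap F E b = c * σ c * algebraMap F E a := by
  obtain ⟨n, f, P, hn, hP, hPa⟩ := ha
  obtain ⟨m, g, Q, hm, hQ, hQb⟩ := hb
  obtain rfl : n = m := Nat.pow_left_injective two_ne_zero (hn.symm.trans hm)
  have hn' : finrank F A = Fintype.card (Fin n) ^ 2 := by simpa using hn
  have hne := nonempty_of_finrank_eq hn'
  obtain ⟨T, T', hTT', hTT, hT⟩ := exists_conj f g hn'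
  have hT' : ∀ x, T' * g x = f x * T' := fun x => by
    calc T' * g x = T' * (g x * T) * T' := by rw [mul_assoc, mul_assoc, hTT', mul_one]
      _ = f x * T' := by rw [hT, ← mul_assoc, hTT, one_mul]
  have ha0 : algebraMap F E a ≠ 0 := by simp
  -- The inverse of `P`, read off from `P * σ P = a`.
  let P' := (algebraMap F E a)⁻¹ • σ.mapMatrix P
  have hPP : P * P' = 1 := by
    rw [mul_smul_comm, hPa, smul_smul, inv_mul_cancel₀ ha0, one_smul]
  have hPP' : P' * P = 1 := mul_eq_one_comm.mp hPP
  have hP' : ∀ x, P' * f x = σ.mapMatrix (f x) * P' := fun x => by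
    calc P' * f x = P' * (f x * P) * P' := by rw [mul_assoc, mul_assoc, hPP, mul_one]
      _ = σ.mapMatrix (f x) * P' := by rw [← hP, ← mul_assoc, hPP', one_mul]
  let R := T' * Q * σ.mapMatrix T
  have hR : ∀ x, R * σ.mapMatrix (f x) = f x * R := fun x => by
    calc R * σ.mapMatrix (f x) = T' * (Q * σ.mapMatrix (T * f x)) := by
          simp only [R, map_mul, mul_assoc]
      _ = T' * (Q * σ.mapMatrix (g x)) * σ.mapMatrix T := by
          rw [← hT, map_mul]
          simp only [mul_assoc]
      _ = f x * R := by
          rw [hQ, ← mul_assoc, hT']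
          simp only [R, mul_assoc]
  have hRb : R * σ.mapMatrix R = algebraMap F E b • 1 := by
    have h1 : σ.mapMatrix T * σ.mapMatrix T' = 1 := by
      rw [← map_mul, hTT', map_one]
    calc R * σ.mapMatrix R = T' * (Q * ((σ.mapMatrix T * σ.mapMatrix T') *
          σ.mapMatrix Q)) * T := by
            simp only [R, map_mul, mul_assoc, hσ.mapMatrix_mapMatrix]
      _ = algebraMap F E b • 1 := by
            rw [h1, one_mul, hQb, mul_smul_comm, mul_one, smul_mul_assoc, hTT]
  obtain ⟨c, hc⟩ := exists_smul_one_of_commute f hn' (C := R * P') fun x => by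
    rw [mul_assoc, hP', ← mul_assoc, hR, mul_assoc]
  have hRc : R = c • P := by
    calc R = R * P' * P := by rw [mul_assoc, hPP', mul_one]
      _ = c • P := by rw [hc, smul_mul_assoc, one_mul]
  have hb : algebraMap F E b = c * σ c * algebraMap F E a := by
    rw [hRc, mapMatrix_smul', smul_mul_smul_comm, hPa, smul_smul] at hRb
    exact (smul_left_injective E (one_ne_zero (α := Matrix (Fin n) (Fin n) E)) hRb).symm
  have hc0 : c ≠ 0 := by
    rintro rfl
    simp at hb
  exact ⟨Units.mk0 c hc0, hb⟩

end HasFactor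

end Quadratic
-- Galois descent along a quadratic extension.
section QuadraticBrauer

open Module Matrix

universe u

variable {F E : Type u} [Field F] [Field E] [Algebra F E] {σ : E →ₐ[F] E}

theorem IsConjugation.finrank_eq_two (hσ : IsConjugation σ) : finrank F E = 2 := by
  obtain ⟨θ, hθ⟩ := hσ.exists_ne
  have hθ' : θ - σ θ ≠ 0 := sub_ne_zero.mpr hθ.symm
  have hli : LinearIndependent F ![1, θ] := by
    rw [LinearIndependent.pair_iff]
    intro s t hst
    have h1 := congrArg σ hst
    simp only [map_add, map_smul, map_one, map_zero] at h1
    have h2 : t • (θ - σ θ) = 0 := by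
      rw [smul_sub, sub_eq_zero]
      exact add_left_cancel (hst.trans h1.symm)
    have ht : t = 0 := (smul_eq_zero.mp h2).resolve_right hθ'
    subst ht
    simpa using hst
  have hspan : ⊤ ≤ Submodule.span F (Set.range ![1, θ]) := by
    intro e _
    -- Solving `e = a + b θ` together with its conjugate gives this `b`.
    obtain ⟨b, hb⟩ := hσ.fixed ((e - σ e) / (θ - σ θ)) (by
      rw [map_div₀, map_sub, map_sub, hσ.involutive, hσ.involutive, ← neg_sub e, ← neg_sub θ,
        neg_div_neg_eq])
    have hb' : e - σ e = algebraMap F E b * (θ - σ θ) := by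
      rw [hb, div_mul_cancel₀ _ hθ']
    obtain ⟨a, ha⟩ := hσ.fixed (e - algebraMap F E b * θ) (by
      rw [map_sub, map_mul, AlgHom.commutes]
      linear_combination -hb')
    rw [Matrix.range_cons, Matrix.range_cons, Matrix.range_empty, Set.union_empty,
      Set.singleton_union, Submodule.mem_span_pair]
    refine ⟨a, b, ?_⟩
    rw [Algebra.smul_def, Algebra.smul_def, ha]
    ring
  rw [Module.finrank_eq_card_basis (Basis.mk hli hspan), Fintype.card_fin]

section FixedSpace

variable {ι : Type*} [Fintype ι] [DecidableEq ι]

theorem comp_mulVec (σ : E →ₐ[F] E) (X : Matrix ι ι E) (v : ι → E) :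
    σ ∘ (X *ᵥ v) = σ.mapMatrix X *ᵥ (σ ∘ v) := by
  ext i
  simp [mulVec, dotProduct]

/-- The vectors fixed by the semilinear map `v ↦ P * σ v`. -/
def fixedSpace (σ : E →ₐ[F] E) (P : Matrix ι ι E) : Submodule F (ι → E) where
  carrier := {v | P *ᵥ (σ ∘ v) = v}
  zero_mem' := by
    have : σ ∘ (0 : ι → E) = 0 := by ext; simp
    simp [this]
  add_mem' {v w} hv hw := by
    have : σ ∘ (v + w) = σ ∘ v + σ ∘ w := by ext; simp
    simp only [Set.mem_ofPred_eq] at hv hw ⊢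
    rw [this, mulVec_add, hv, hw]
  smul_mem' c v hv := by
    have : σ ∘ (c • v) = c • (σ ∘ v) := by ext; simp
    simp only [Set.mem_ofPred_eq] at hv ⊢
    rw [this, mulVec_smul, hv]

theorem mem_fixedSpace {ι : Type*} [Fintype ι] {P : Matrix ι ι E} {v : ι → E} :
    v ∈ fixedSpace σ P ↔ P *ᵥ (σ ∘ v) = v := Iff.rfl

/-- The matrices compatible with the semilinear map `v ↦ P * σ v` act on its fixed vectors. -/
def fixedSpaceAction {A : Type*} [Ring A] [Algebra F A] (f : A →ₐ[F] Matrix ι ι E)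
    (P : Matrix ι ι E) (hP : ∀ x, P * σ.mapMatrix (f x) = f x * P) :
    A →ₐ[F] End F (fixedSpace σ P) where
  toFun x :=
    { toFun := fun w => ⟨f x *ᵥ w, by
        rw [mem_fixedSpace, comp_mulVec, mulVec_mulVec, hP, ← mulVec_mulVec,
          mem_fixedSpace.mp w.2]⟩
      map_add' := fun v w => Subtype.ext (mulVec_add _ _ _)
      map_smul' := fun c v => Subtype.ext (mulVec_smul _ _ _) }
  map_one' := by ext1 w; simp
  map_mul' x y := by ext1 w; simp
  map_zero' := by ext1 w; simp
  map_add' x y := by ext1 w; simp [add_mulVec]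
  commutes' c := by
    ext1 w
    simp [Algebra.algebraMap_eq_smul_one, smul_mulVec]
    rfl

/-- Each `v + P * σ v` is fixed. If all of these vanished, `v ↦ P * σ v` would be `-1`, which is
linear and cannot also be `σ`-semilinear. -/
theorem exists_ne_zero_mem_fixedSpace [Nonempty ι] (hσ : IsConjugation σ) {P : Matrix ι ι E}
    (hP : P * σ.mapMatrix P = 1) : ∃ v ∈ fixedSpace σ P, v ≠ 0 := by
  obtain ⟨θ, hθ⟩ := hσ.exists_ne
  by_contra! hcon
  have hadd : ∀ v : ι → E, v + P *ᵥ (σ ∘ v) = 0 := fun v => hcon _ <| by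
    have h1 : σ ∘ (v + P *ᵥ (σ ∘ v)) = σ ∘ v + σ.mapMatrix P *ᵥ v := by
      have h2 : σ ∘ (σ ∘ v) = v := by ext; simp [hσ.involutive]
      rw [← congrArg (σ.mapMatrix P *ᵥ ·) h2, ← comp_mulVec]
      ext
      simp
    rw [mem_fixedSpace, h1, mulVec_add, mulVec_mulVec, hP, one_mulVec, add_comm]
  obtain ⟨i⟩ := ‹Nonempty ι›
  have h1 := hadd (Pi.single i 1)
  have h2 := hadd (θ • Pi.single i 1)
  have h3 : σ ∘ (θ • Pi.single i 1 : ι → E) = σ θ • (σ ∘ (Pi.single i 1 : ι → E)) := by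
    ext
    simp
  rw [h3, mulVec_smul, eq_neg_of_add_eq_zero_right h1, smul_neg,
    ← sub_eq_add_neg, ← sub_smul] at h2
  have h4 := congrFun h2 i
  simp only [Pi.smul_apply, Pi.single_eq_same, smul_eq_mul, mul_one, Pi.zero_apply] at h4
  exact hθ (sub_eq_zero.mp h4).symm

/-- Two copies of the fixed space `W` embed in `ι → E` by `(v, w) ↦ v + θ w`: applying the
semilinear map to a relation replaces `θ` by `σ θ`. Hence `2 dim W ≤ 2 |ι|`. -/
theorem finrank_fixedSpace_le (hσ : IsConjugation σ) (P : Matrix ι ι E) :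
    finrank F (fixedSpace σ P) ≤ Fintype.card ι := by
  have h2 := hσ.finrank_eq_two
  have : FiniteDimensional F E := Module.finite_of_finrank_eq_succ h2
  obtain ⟨θ, hθ⟩ := hσ.exists_ne
  let W := fixedSpace σ P
  let l : W × W →ₗ[F] (ι → E) :=
    { toFun := fun w => w.1 + θ • (w.2 : ι → E)
      map_add' := fun v w => by
        simp only [Prod.fst_add, Prod.snd_add, Submodule.coe_add, smul_add]
        abel
      map_smul' := fun c w => by
        simp only [Prod.smul_fst, Prod.smul_snd, SetLike.val_smul, smul_add, RingHom.id_apply]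
        rw [smul_comm θ c] }
  have hl : Function.Injective l := by
    rw [injective_iff_map_eq_zero]
    rintro ⟨v, w⟩ hvw
    replace hvw : (v : ι → E) + θ • (w : ι → E) = 0 := hvw
    have h3 : (v : ι → E) + σ θ • (w : ι → E) = 0 := by
      have h4 : P *ᵥ (σ ∘ ((v : ι → E) + θ • (w : ι → E))) = 0 := by
        have h5 : σ ∘ (0 : ι → E) = 0 := by ext; simp
        rw [hvw, h5, mulVec_zero]
      have h5 : σ ∘ ((v : ι → E) + θ • (w : ι → E)) = σ ∘ v.1 + σ θ • (σ ∘ w.1) := by ext; simp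
      rwa [h5, mulVec_add, mulVec_smul, mem_fixedSpace.mp v.2, mem_fixedSpace.mp w.2] at h4
    have h4 : (θ - σ θ) • (w : ι → E) = 0 := by
      rw [sub_smul, sub_eq_zero]
      exact add_left_cancel (hvw.trans h3.symm)
    have hw : (w : ι → E) = 0 :=
      (smul_eq_zero.mp h4).resolve_left (sub_ne_zero.mpr hθ.symm)
    rw [hw, smul_zero, add_zero] at hvw
    exact Prod.ext (Subtype.ext hvw) (Subtype.ext hw)
  have := LinearMap.finrank_le_finrank_of_injective hl
  rw [Module.finrank_prod, Module.finrank_pi_fintype] at this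
  simp only [h2, Finset.sum_const, Finset.card_univ, smul_eq_mul] at this
  change finrank F W ≤ _
  omega

end FixedSpace

/-- The simple algebra `A` acts faithfully on the nonzero fixed space `W`, so `n² = dim A ≤ (dim W)²
≤ n²`. Equality makes `A` all of `End W`. -/
theorem HasFactor.exists_algEquiv_matrix (hσ : IsConjugation σ) {A : Type u} [Ring A] [Algebra F A]
    [IsSimpleRing A] [FiniteDimensional F A] (h : HasFactor σ A 1) :
    ∃ n ≠ 0, Nonempty (A ≃ₐ[F] Matrix (Fin n) (Fin n) F) := by
  obtain ⟨n, f, P, hn, hP, hPa⟩ := h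
  have h2 := hσ.finrank_eq_two
  have : FiniteDimensional F E := Module.finite_of_finrank_eq_succ h2
  have hne : Nonempty (Fin n) := nonempty_of_finrank_eq (F := F) (A := A) (by simpa using hn)
  rw [Units.val_one, map_one, one_smul] at hPa
  obtain ⟨v, hv, hv0⟩ := exists_ne_zero_mem_fixedSpace hσ hPa
  let W := fixedSpace σ P
  have : Nontrivial W := ⟨⟨v, hv⟩, 0, fun h => hv0 (congrArg Subtype.val h)⟩
  let g : A →ₐ[F] End F W := fixedSpaceAction f P hP
  have hg : Function.Injective g := g.toRingHom.injective
  have h3 := LinearMap.finrank_le_finrank_of_injective (f := g.toLinearMap) hg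
  have h4 : finrank F W ≤ n := by simpa using finrank_fixedSpace_le hσ P
  rw [Module.finrank_linearMap F F W W, hn, ← sq] at h3
  have h5 : finrank F W = n := le_antisymm h4 ((Nat.pow_le_pow_iff_left two_ne_zero).mp h3)
  have h6 : finrank F A = finrank F (End F W) := by
    rw [Module.finrank_linearMap F F W W, hn, h5, sq]
  have hs : Function.Surjective g := by
    have h7 := LinearMap.injective_iff_surjective_of_finrank_eq_finrank (K := F) (V := A)
      (V₂ := End F W) h6 (f := g.toLinearMap)
    exact h7.mp hg
  refine ⟨n, (Fin.pos_iff_nonempty.mpr hne).ne', ⟨(AlgEquiv.ofBijective g ⟨hg, hs⟩).trans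
    (algEquivMatrix (Module.finBasisOfFinrankEq F W h5))⟩⟩

/-! ### Quaternion algebras realizing every factor. -/

section Cyclic

variable (σ) in
/-- The matrix whose semilinear square is the scalar `a`. -/
def cyclicMatrix (a : Fˣ) : Matrix (Fin 2) (Fin 2) E := !![0, algebraMap F E a; 1, 0]

variable (σ) in
/-- The quaternion algebra attached to `σ` and `a`: the matrices `!![x, a * σ y; y, σ x]`. -/
def cyclicAlgebra (a : Fˣ) : Subalgebra F (Matrix (Fin 2) (Fin 2) E) where
  carrier := {X | cyclicMatrix a * σ.mapMatrix X = X * cyclicMatrix a}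
  mul_mem' {X Y} hX hY := by
    simp only [Set.mem_ofPred_eq] at hX hY ⊢
    rw [map_mul, ← mul_assoc, hX, mul_assoc, hY, mul_assoc]
  add_mem' {X Y} hX hY := by
    simp only [Set.mem_ofPred_eq] at hX hY ⊢
    rw [map_add, mul_add, hX, hY, add_mul]
  algebraMap_mem' c := by
    simp only [Set.mem_ofPred_eq]
    rw [AlgHom.commutes, Algebra.commutes]

theorem cyclicMatrix_mul_map (a : Fˣ) :
    cyclicMatrix a * σ.mapMatrix (cyclicMatrix a) = algebraMap F E a • 1 := by
  ext i j
  fin_cases i <;> fin_cases j <;> simp [cyclicMatrix, mul_apply]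

variable {a : Fˣ}

theorem mem_cyclicAlgebra (hσ : IsConjugation σ) {X : Matrix (Fin 2) (Fin 2) E} :
    X ∈ cyclicAlgebra σ a ↔ X 0 1 = algebraMap F E a * σ (X 1 0) ∧ X 1 1 = σ (X 0 0) := by
  change cyclicMatrix a * σ.mapMatrix X = X * cyclicMatrix a ↔ _
  rw [← Matrix.ext_iff]
  simp only [Fin.forall_fin_two, cyclicMatrix, mul_apply, Fin.sum_univ_two, AlgHom.mapMatrix_apply,
    map_apply, of_apply, cons_val_zero, cons_val_one, cons_val', cons_val_fin_one, zero_mul,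
    one_mul, mul_zero, mul_one, zero_add, add_zero]
  constructor
  · rintro ⟨⟨h1, -⟩, h2, -⟩
    exact ⟨h1.symm, h2.symm⟩
  · rintro ⟨h1, h2⟩
    refine ⟨⟨h1.symm, ?_⟩, h2.symm, ?_⟩
    · rw [h2, hσ.involutive, mul_comm]
    · rw [h1, map_mul, AlgHom.commutes, hσ.involutive, mul_comm]

/-- The element `x + y * j` of the quaternion algebra. -/
def cyclicElem (hσ : IsConjugation σ) (a : Fˣ) (x y : E) : cyclicAlgebra σ a :=
  ⟨!![x, algebraMap F E a * σ y; y, σ x], (mem_cyclicAlgebra hσ).mpr (by simp)⟩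

theorem exists_cyclicElem (hσ : IsConjugation σ) (z : cyclicAlgebra σ a) :
    ∃ x y, z = cyclicElem hσ a x y := by
  obtain ⟨h1, h2⟩ := (mem_cyclicAlgebra hσ).mp z.2
  refine ⟨z.1 0 0, z.1 1 0, Subtype.ext (Matrix.ext fun i j => ?_)⟩
  fin_cases i <;> fin_cases j <;> simp [cyclicElem, h1, h2]

theorem cyclicElem_mul (hσ : IsConjugation σ) (x y x' y' : E) :
    cyclicElem hσ a x y * cyclicElem hσ a x' y' =
      cyclicElem hσ a (x * x' + algebraMap F E a * σ y * y') (y * x' + σ x * y') := by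
  refine Subtype.ext (Matrix.ext fun i j => ?_)
  fin_cases i <;> fin_cases j <;>
    simp [cyclicElem, hσ.involutive] <;> ring

theorem cyclicElem_sub (hσ : IsConjugation σ) (x y x' y' : E) :
    cyclicElem hσ a x y - cyclicElem hσ a x' y' = cyclicElem hσ a (x - x') (y - y') := by
  refine Subtype.ext (Matrix.ext fun i j => ?_)
  fin_cases i <;> fin_cases j <;> simp [cyclicElem, mul_sub]

theorem cyclicElem_inj (hσ : IsConjugation σ) {x y x' y' : E}
    (h : cyclicElem hσ a x y = cyclicElem hσ a x' y') : x = x' ∧ y = y' := by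
  have h' := congrArg Subtype.val h
  exact ⟨by simpa [cyclicElem] using congrFun (congrFun h' 0) 0,
    by simpa [cyclicElem] using congrFun (congrFun h' 1) 0⟩

theorem cyclicElem_algebraMap (hσ : IsConjugation σ) (c : F) :
    cyclicElem hσ a (algebraMap F E c) 0 = algebraMap F _ c := by
  refine Subtype.ext (Matrix.ext fun i j => ?_)
  fin_cases i <;> fin_cases j <;> simp [cyclicElem, Matrix.algebraMap_matrix_apply]

theorem finrank_cyclicAlgebra (hσ : IsConjugation σ) (a : Fˣ) :
    finrank F (cyclicAlgebra σ a) = 4 := by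
  have h2 := hσ.finrank_eq_two
  have : FiniteDimensional F E := Module.finite_of_finrank_eq_succ h2
  let l : E × E →ₗ[F] cyclicAlgebra σ a :=
    { toFun := fun z => cyclicElem hσ a z.1 z.2
      map_add' := fun z w => by
        refine Subtype.ext (Matrix.ext fun i j => ?_)
        fin_cases i <;> fin_cases j <;> simp [cyclicElem, mul_add]
      map_smul' := fun c z => by
        refine Subtype.ext (Matrix.ext fun i j => ?_)
        fin_cases i <;> fin_cases j <;> simp [cyclicElem] }
  have hl : Function.Bijective l := by
    refine ⟨fun z w h => Prod.ext (cyclicElem_inj hσ h).1 (cyclicElem_inj hσ h).2, fun z => ?_⟩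
    obtain ⟨x, y, rfl⟩ := exists_cyclicElem hσ z
    exact ⟨(x, y), rfl⟩
  rw [← (LinearEquiv.ofBijective l hl).finrank_eq, Module.finrank_prod, h2]

/-- Commuting with `θ` kills `y`; commuting with the element of coordinates `(0, 1)` makes `x` fixed
by `σ`. -/
theorem isCentral_cyclicAlgebra (hσ : IsConjugation σ) (a : Fˣ) :
    Algebra.IsCentral F (cyclicAlgebra σ a) := by
  obtain ⟨θ, hθ⟩ := hσ.exists_ne
  refine ⟨fun z hz => ?_⟩
  rw [Subalgebra.mem_center_iff] at hz
  obtain ⟨x, y, rfl⟩ := exists_cyclicElem hσ z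
  have h1 := hz (cyclicElem hσ a θ 0)
  have h2 := hz (cyclicElem hσ a 0 1)
  rw [cyclicElem_mul, cyclicElem_mul] at h1 h2
  have h1' := (cyclicElem_inj hσ h1).2
  have h2' := (cyclicElem_inj hσ h2).2
  simp only [zero_mul, zero_add, mul_zero, add_zero, one_mul, map_zero, mul_one] at h1' h2'
  have hy : y = 0 := by
    have : (σ θ - θ) * y = 0 := by linear_combination h1'
    exact (mul_eq_zero.mp this).resolve_left (sub_ne_zero.mpr hθ)
  obtain ⟨c, rfl⟩ := hσ.fixed x h2'.symm
  rw [hy, cyclicElem_algebraMap, Algebra.mem_bot]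
  exact ⟨c, rfl⟩

theorem isSimpleRing_cyclicAlgebra (hσ : IsConjugation σ) (a : Fˣ) :
    IsSimpleRing (cyclicAlgebra σ a) := by
  obtain ⟨θ, hθ⟩ := hσ.exists_ne
  have : Nontrivial (cyclicAlgebra σ a) := inferInstance
  have hone : cyclicElem hσ a 1 0 = 1 := by
    simpa using cyclicElem_algebraMap (a := a) hσ 1
  refine ⟨⟨fun I => ?_⟩⟩
  rw [or_iff_not_imp_left]
  intro hI
  obtain ⟨z, hzI, hz⟩ : ∃ z ∈ I, z ≠ 0 := by
    by_contra! hcon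
    exact hI (le_bot_iff.mp fun x hx => by simpa using hcon x hx)
  obtain ⟨x, y, rfl⟩ := exists_cyclicElem hσ z
  rw [← TwoSidedIdeal.one_mem_iff]
  by_cases hy : y = 0
  · subst hy
    have hx : x ≠ 0 := by
      rintro rfl
      exact hz (by simpa using cyclicElem_algebraMap (a := a) hσ 0)
    have := I.mul_mem_right _ (cyclicElem hσ a x⁻¹ 0) hzI
    rw [cyclicElem_mul] at this
    simpa [hx, hone] using this
  -- The commutator with `θ` removes the `x`-coordinate and leaves `w = (θ - σ θ) * y ≠ 0`; an
  -- element of coordinates `(0, w)` is invertible.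
  · have h1 := I.sub_mem (I.mul_mem_right _ (cyclicElem hσ a θ 0) hzI)
      (I.mul_mem_left (cyclicElem hσ a θ 0) _ hzI)
    rw [cyclicElem_mul, cyclicElem_mul, cyclicElem_sub] at h1
    set w := y * θ + σ x * 0 - (0 * x + σ θ * y) with hw
    have hw0 : w ≠ 0 := by
      have : w = (θ - σ θ) * y := by rw [hw]; ring
      rw [this]
      exact mul_ne_zero (sub_ne_zero.mpr hθ.symm) hy
    have hv : x * θ + algebraMap F E a * σ y * 0 - (θ * x + algebraMap F E a * σ 0 * y) = 0 := by
      rw [map_zero]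
      ring
    rw [hv] at h1
    have hw1 : algebraMap F E a * σ w ≠ 0 :=
      mul_ne_zero (by simp) ((map_ne_zero_iff σ σ.toRingHom.injective).mpr hw0)
    have h2 := I.mul_mem_right _ (cyclicElem hσ a 0 (algebraMap F E a * σ w)⁻¹) h1
    rw [cyclicElem_mul, mul_inv_cancel₀ hw1] at h2
    simpa [hone] using h2

theorem hasFactor_cyclicAlgebra (hσ : IsConjugation σ) (a : Fˣ) :
    HasFactor σ (cyclicAlgebra σ a) a :=
  ⟨2, (cyclicAlgebra σ a).val, cyclicMatrix a, finrank_cyclicAlgebra hσ a, fun x => x.2,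
    cyclicMatrix_mul_map a⟩

end Cyclic

end QuadraticBrauer

/-! ### The relative Brauer group as units modulo norms. -/

section RelativeBrauer

open Module Matrix

universe u

variable {F E : Type u} [Field F] [Field E] [Algebra F E] {σ : E →ₐ[F] E}

/-- The norms from `E` in the multiplicative group of `F`. -/
def normUnits (σ : E →ₐ[F] E) : Subgroup Fˣ where
  carrier := {d | ∃ c : Eˣ, algebraMap F E d = c * σ c}
  one_mem' := ⟨1, by simp⟩
  mul_mem' := by
    rintro d d' ⟨c, hc⟩ ⟨c', hc'⟩
    refine ⟨c * c', ?_⟩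
    rw [Units.val_mul, Units.val_mul, map_mul, map_mul, hc, hc']
    ring
  inv_mem' := by
    rintro d ⟨c, hc⟩
    refine ⟨c⁻¹, ?_⟩
    rw [Units.val_inv_eq_inv_val, Units.val_inv_eq_inv_val, map_inv₀, map_inv₀, hc, mul_inv]

theorem brauer_mk_eq_one {A : CSA.{u, u} F} {n : ℕ} (hn : n ≠ 0)
    (e : A ≃ₐ[F] Matrix (Fin n) (Fin n) F) : (⟦A⟧ : BrauerGroup.{u, u} F) = 1 :=
  Quotient.sound ⟨1, n, one_ne_zero, hn, ⟨(matrixFinOneEquiv F A).trans e⟩⟩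

/-- Passing to a matrix algebra keeps the factor, so the comparison takes place on one algebra. -/
theorem HasFactor.coe_eq_of_isBrauerEquivalent (hσ : IsConjugation σ) {A B : CSA.{u, u} F}
    (h : IsBrauerEquivalent A B) {a b : Fˣ} (ha : HasFactor σ A a) (hb : HasFactor σ B b) :
    (a : Fˣ ⧸ normUnits σ) = b := by
  obtain ⟨n, m, hn, hm, ⟨e⟩⟩ := h
  have : Nonempty (Fin m) := Fin.pos_iff_nonempty.mp (Nat.pos_of_ne_zero hm)
  have : IsSimpleRing (Matrix (Fin m) (Fin m) B) := inferInstance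
  obtain ⟨c, hc⟩ := eq_norm_mul hσ ((ha.matrix (n := n)).congr e) (hb.matrix (n := m))
  rw [QuotientGroup.eq]
  refine ⟨c, ?_⟩
  rw [Units.val_mul, map_mul, hc, mul_comm, mul_assoc, ← map_mul, Units.mul_inv, map_one, mul_one]

theorem exists_factor (hσ : IsConjugation σ) (x : relBrauerGroup F E) :
    ∃ A : CSA.{u, u} F, (⟦A⟧ : BrauerGroup F) = x ∧ ∃ a : Fˣ, HasFactor σ A a := by
  obtain ⟨_, A, rfl, n, ⟨e⟩⟩ := x
  exact ⟨A, rfl, HasFactor.exists_of_split hσ e⟩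

/-- The class modulo norms attached to a Brauer class that splits over `E`. -/
noncomputable def factorClass (hσ : IsConjugation σ) (x : relBrauerGroup F E) :
    Fˣ ⧸ normUnits σ :=
  ((exists_factor hσ x).choose_spec.2.choose : Fˣ)

theorem factorClass_eq (hσ : IsConjugation σ) {x : relBrauerGroup F E} {A : CSA.{u, u} F}
    (hA : (⟦A⟧ : BrauerGroup F) = x) {a : Fˣ} (ha : HasFactor σ A a) : factorClass hσ x = a :=
  HasFactor.coe_eq_of_isBrauerEquivalent hσ
    (Quotient.exact ((exists_factor hσ x).choose_spec.1.trans hA.symm))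
    (exists_factor hσ x).choose_spec.2.choose_spec ha

/-- The relative Brauer group of a quadratic Galois extension is the multiplicative group of the
base modulo norms. -/
noncomputable def relBrauerEquiv (hσ : IsConjugation σ) :
    relBrauerGroup F E ≃* Fˣ ⧸ normUnits σ :=
  MulEquiv.ofBijective (MonoidHom.mk' (factorClass hσ) fun x y => by
    obtain ⟨A, hA, a, ha⟩ := exists_factor hσ x
    obtain ⟨B, hB, b, hb⟩ := exists_factor hσ y
    have hAB : (⟦tensorCSA A B⟧ : BrauerGroup F) = (x * y : relBrauerGroup F E) := by
      rw [Subgroup.coe_mul, ← hA, ← hB]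
      rfl
    rw [factorClass_eq hσ hA ha, factorClass_eq hσ hB hb,
      factorClass_eq hσ hAB (a := a * b) (ha.tensor hb), QuotientGroup.mk_mul]) <| by
    constructor
    · rw [injective_iff_map_eq_one]
      intro x hx
      obtain ⟨A, hA, a, ha⟩ := exists_factor hσ x
      rw [MonoidHom.mk'_apply, factorClass_eq hσ hA ha, QuotientGroup.eq_one_iff] at hx
      -- As `a⁻¹` is a norm, rescaling `P` makes the factor 1, and descent applies.
      obtain ⟨c, hc⟩ := inv_mem hx
      have h1 := ha.mul_norm hc
      rw [inv_mul_cancel] at h1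
      obtain ⟨n, hn, ⟨e⟩⟩ := h1.exists_algEquiv_matrix hσ
      exact Subtype.ext (hA.symm.trans (brauer_mk_eq_one hn e))
    · intro q
      obtain ⟨a, rfl⟩ := QuotientGroup.mk_surjective q
      have hf := hasFactor_cyclicAlgebra hσ a
      have := isCentral_cyclicAlgebra hσ a
      have := isSimpleRing_cyclicAlgebra hσ a
      have : FiniteDimensional F (cyclicAlgebra σ a) :=
        Module.finite_of_finrank_eq_succ (finrank_cyclicAlgebra hσ a)
      let A : CSA.{u, u} F := { AlgCat.of F (cyclicAlgebra σ a) with }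
      exact ⟨⟨⟦A⟧, A, rfl, hf.splits⟩, factorClass_eq hσ (A := A) rfl hf⟩

theorem relBrauerGroup_subsingleton (h : Function.Surjective (algebraMap F E)) :
    Subsingleton (relBrauerGroup F E) := by
  refine subsingleton_of_forall_eq 1 ?_
  rintro ⟨_, A, rfl, n, ⟨e⟩⟩
  let i : E ≃ₐ[F] F :=
    (AlgEquiv.ofBijective (Algebra.ofId F E) ⟨(algebraMap F E).injective, h⟩).symm
  let e1 : A ≃ₐ[F] Matrix (Fin n) (Fin n) F :=
    (Algebra.TensorProduct.lid F A).symm.trans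
      ((Algebra.TensorProduct.congr i.symm AlgEquiv.refl).trans
        ((e.restrictScalars F).trans i.mapMatrix))
  refine Subtype.ext (brauer_mk_eq_one ?_ e1)
  -- Size 0 would make the simple ring `A` trivial.
  rintro rfl
  have := e1.toEquiv.subsingleton
  exact not_subsingleton A this

end RelativeBrauer

/-! ### The projection formula, and induction versus coinduction. -/

section InducedModules

open Representation

variable {R G H A M X : Type*} [CommRing R] [Group G] [Group H] [AddCommGroup A] [Module R A]
  [AddCommGroup M] [Module R M] [AddCommGroup X] [Module R X]

/-- The linear map on an induced module given by its values on the classes `⟦g ⊗ₜ a⟧`. -/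
noncomputable def indLift (ι : H →* G) (ρ : Representation R H A) (f : G → A →ₗ[R] X)
    (hf : ∀ h g a, f (ι h * g) (ρ h a) = f g a) : IndV ι ρ →ₗ[R] X :=
  Coinvariants.lift _ (TensorProduct.lift (Finsupp.lsum R (fun g =>
    LinearMap.toSpanSingleton R _ (f g)) ∘ₗ (MonoidAlgebra.coeffLinearEquiv R).toLinearMap))
    fun h => by
      ext g a
      simp [hf]

theorem indLift_mk (ι : H →* G) (ρ : Representation R H A) (f : G → A →ₗ[R] X)
    (hf : ∀ h g a, f (ι h * g) (ρ h a) = f g a) (g : G) (a : A) :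
    indLift ι ρ f hf (IndV.mk ι ρ g a) = f g a := by
  simp [indLift]

theorem indV_mk_map_mul (ι : H →* G) (ρ : Representation R H A) (h : H) (g : G) (a : A) :
    IndV.mk ι ρ (ι h * g) (ρ h a) = IndV.mk ι ρ g a := by
  have := Coinvariants.mk_self_apply (tprod ((leftRegular R G).comp ι) ρ) h
    (MonoidAlgebra.single g 1 ⊗ₜ a)
  simpa using this

/-- The projection formula `Ind(A) ⊗ M ≅ Ind(A ⊗ Res M)`. -/
noncomputable def indTensorEquiv (ι : H →* G) (ρ : Representation R H A)
    (τ : Representation R G M) :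
    (tprod (ind ι ρ) τ).Equiv (ind ι (tprod ρ (τ.comp ι))) :=
  -- In this model the class of `g ⊗ₜ a` is the usual `g⁻¹ ⊗ a`, so `m` is moved by `τ g`, and by `τ
  -- g⁻¹` in the inverse map.
  let f : IndV ι ρ ⊗[R] M →ₗ[R] IndV ι (tprod ρ (τ.comp ι)) := TensorProduct.lift <|
    indLift ι ρ (fun g => ((TensorProduct.mk R A M).compl₂ (τ g)).compr₂ (IndV.mk ι _ g))
      fun h g a => by
        refine LinearMap.ext fun m => ?_
        have := indV_mk_map_mul ι (tprod ρ (τ.comp ι)) h g (a ⊗ₜ τ g m)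
        simpa using this
  have hf : ∀ g a m, f (IndV.mk ι ρ g a ⊗ₜ m) = IndV.mk ι _ g (a ⊗ₜ τ g m) := fun g a m => by
    simp only [f, TensorProduct.lift.tmul]
    rw [indLift_mk]
    rfl
  let i : IndV ι (tprod ρ (τ.comp ι)) →ₗ[R] IndV ι ρ ⊗[R] M :=
    indLift ι _ (fun g => TensorProduct.map (IndV.mk ι ρ g) (τ g⁻¹)) fun h g z => by
      induction z using TensorProduct.induction_on with
      | zero => simp
      | tmul a m =>
        have := indV_mk_map_mul ι ρ h g a
        rw [Representation.tprod_apply, TensorProduct.map_tmul, TensorProduct.map_tmul,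
          TensorProduct.map_tmul, this]
        congr 1
        simp
      | add x y hx hy => rw [map_add, map_add, map_add, hx, hy]
  have hi : ∀ g a m, i (IndV.mk ι _ g (a ⊗ₜ m)) = IndV.mk ι ρ g a ⊗ₜ τ g⁻¹ m :=
    fun g a m => by
      simp only [i]
      rw [indLift_mk]
      rfl
  .mk (.ofLinearMap f i
    (IndV.hom_ext _ _ fun g => TensorProduct.ext' fun a m => by
      change f (i (IndV.mk ι _ g (a ⊗ₜ m))) = IndV.mk ι _ g (a ⊗ₜ m)
      rw [hi, hf, self_inv_apply])
    (TensorProduct.ext (IndV.hom_ext _ _ fun g => LinearMap.ext fun a => LinearMap.ext fun m => by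
      change i (f (IndV.mk ι ρ g a ⊗ₜ m)) = IndV.mk ι ρ g a ⊗ₜ m
      rw [hf, hi, inv_self_apply]))) fun g =>
    TensorProduct.ext (IndV.hom_ext _ _ fun x => LinearMap.ext fun a => LinearMap.ext fun m => by
      change f (ind ι ρ g (IndV.mk ι ρ x a) ⊗ₜ τ g m) =
        ind ι _ g (f (IndV.mk ι ρ x a ⊗ₜ m))
      rw [ind_mk, hf, hf, ind_mk, map_mul, Module.End.mul_apply, inv_self_apply])

open scoped Classical in
/-- For a subgroup of finite index, the induced and the coinduced modules agree. -/
noncomputable def indEquivCoind {R : Type} {G A : Type*} [CommRing R] [Group G] [AddCommGroup A]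
    [Module R A] (N : Subgroup G) [N.FiniteIndex] (ρ : Representation R N A) :
    (ind N.subtype ρ).Equiv (coind N.subtype ρ) :=
  .mk (.ofLinearMap (Rep.indToCoind (Rep.of ρ)) (Rep.coindToInd (Rep.of ρ))
    (Rep.coindToInd_indToCoind (Rep.of ρ)) (Rep.indToCoind_coindToInd (Rep.of ρ))) fun g => by
      exact (Rep.indCoindIso (Rep.of ρ)).hom.hom.isIntertwining' g

end InducedModules

/-! ### The torus module as a tensor product. -/

section Torus

variable {k K : Type*} [Field k] [Field K] [Algebra k K]

/-- If the matrices of `ρ` in a basis are those of `φ`, then the torus module of `φ` is the tensor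
product of `ρ` with the multiplicative group. -/
noncomputable def torusEquivTensor {n : ℕ} (φ : (K ≃ₐ[k] K) →* GL (Fin n) ℤ) {V : Type*}
    [AddCommGroup V] (ρ : Representation ℤ (K ≃ₐ[k] K) V) (S : Module.Basis (Fin n) ℤ V)
    (h : ∀ g i, ρ g (S i) = ∑ j, (φ g : Matrix (Fin n) (Fin n) ℤ) j i • S j) :
    (torusRep φ).Equiv (Representation.tprod ρ (unitsRep k K)) :=
  let e₁ : Additive (Fin n → Kˣ) ≃ₗ[ℤ] (Fin n → Additive Kˣ) :=
    AddEquiv.toIntLinearEquiv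
      { toFun := fun x i => Additive.ofMul (x.toMul i)
        invFun := fun x => Additive.ofMul fun i => (x i).toMul
        left_inv := fun _ => rfl
        right_inv := fun _ => rfl
        map_add' := fun _ _ => rfl }
  let e : Additive (Fin n → Kˣ) ≃ₗ[ℤ] V ⊗[ℤ] Additive Kˣ :=
    e₁.trans ((Finsupp.linearEquivFunOnFinite ℤ (Additive Kˣ) (Fin n)).symm.trans
      (TensorProduct.equivFinsuppOfBasisLeft S).symm)
  have he : ∀ x, e x = ∑ i, S i ⊗ₜ Additive.ofMul (x.toMul i) := fun x => by
    change (TensorProduct.equivFinsuppOfBasisLeft S).symm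
      ((Finsupp.linearEquivFunOnFinite ℤ (Additive Kˣ) (Fin n)).symm (e₁ x)) = _
    rw [TensorProduct.equivFinsuppOfBasisLeft_symm_apply, Finsupp.sum_fintype _ _ (by simp)]
    rfl
  .mk e fun g => LinearMap.ext fun x => by
    change e (torusRep φ g x) = Representation.tprod ρ (unitsRep k K) g (e x)
    have h1 : ∀ j, Additive.ofMul ((torusRep φ g x).toMul j) =
        ∑ i, (φ g : Matrix (Fin n) (Fin n) ℤ) j i •
          unitsRep k K g (Additive.ofMul (x.toMul i)) := fun j => rfl
    rw [he, he, map_sum]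
    simp_rw [h1, Representation.tprod_apply, TensorProduct.map_tmul, h, TensorProduct.tmul_sum,
      TensorProduct.sum_tmul, TensorProduct.smul_tmul]
    exact Finset.sum_comm

theorem SimilarToOperators.nonempty_torusEquiv {n m : ℕ} {φ : (K ≃ₐ[k] K) →* GL (Fin n) ℤ}
    {g : Fin m → (K ≃ₐ[k] K)} (hg : Subgroup.closure (Set.range g) = ⊤) {V : Type*}
    [AddCommGroup V] {ρ : Representation ℤ (K ≃ₐ[k] K) V}
    (hsim : SimilarToOperators (fun i => (φ (g i) : Matrix (Fin n) (Fin n) ℤ)) fun i => ρ (g i)) :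
    Nonempty ((torusRep φ).Equiv (Representation.tprod ρ (unitsRep k K))) := by
  obtain ⟨S, T, hT⟩ := hsim
  let T₁ : Matrix (Fin n) (Fin n) ℤ := ((T⁻¹ : GL (Fin n) ℤ) : Matrix (Fin n) (Fin n) ℤ)
  let T₂ : Matrix (Fin n) (Fin n) ℤ := T
  have h12 : T₁ * T₂ = 1 := T.inv_mul
  have h21 : T₂ * T₁ = 1 := T.mul_inv
  -- `L` has matrix `T⁻¹` in `S`. Since `ρ` has matrix `T⁻¹ φ T` in `S`, it has matrix `φ` in the
  -- basis `S.map L`.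
  let L : V ≃ₗ[ℤ] V := Matrix.toLinOfInv S S h12 h21
  have hconj : ∀ x, T₁ * φ x * T₂ = LinearMap.toMatrix S S (ρ x) := by
    have h0 : ∀ f, LinearMap.toMatrixAlgEquiv S f = LinearMap.toMatrix S S f := fun _ => rfl
    have h1 : ((Units.coeHom _).comp ((MulAut.conj T⁻¹).toMonoidHom.comp φ) :
        (K ≃ₐ[k] K) →* Matrix (Fin n) (Fin n) ℤ) =
        (LinearMap.toMatrixAlgEquiv S : _ →* Matrix (Fin n) (Fin n) ℤ).comp ρ := by
      refine MonoidHom.eq_of_eqOn_dense hg ?_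
      rintro _ ⟨i, rfl⟩
      have := hT i
      simpa [T₁, T₂, h0] using this
    intro x
    have := DFunLike.congr_fun h1 x
    simpa [T₁, T₂, h0] using this
  refine ⟨torusEquivTensor φ ρ (S.map L) fun x i => ?_⟩
  have h2 : ρ x ∘ₗ L.toLinearMap =
      L.toLinearMap ∘ₗ Matrix.toLin S S (φ x : Matrix (Fin n) (Fin n) ℤ) := by
    apply (LinearMap.toMatrix S S).injective
    have hL : LinearMap.toMatrix S S L.toLinearMap = T₁ := LinearMap.toMatrix_toLin S S T₁
    rw [LinearMap.toMatrix_comp S S S, LinearMap.toMatrix_comp S S S, ← hconj, hL,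
      LinearMap.toMatrix_toLin, mul_assoc, h21, mul_one]
  have h3 := LinearMap.congr_fun h2 (S i)
  simp only [LinearMap.comp_apply, Matrix.toLin_self, map_sum, map_smul] at h3
  simpa using h3

end Torus

/-! ### Functoriality of H¹ and Shapiro's lemma. -/

section FirstCohomology

variable {R G V W X : Type*} [CommRing R] [Group G] [AddCommGroup V] [Module R V]
  [AddCommGroup W] [Module R W] [AddCommGroup X]

theorem H1_mk_eq_zero (ρ : Representation R G V) (c : cocycles1 ρ) :
    (c : H1 ρ) = 0 ↔ ∃ v, ∀ g, c.1 g = ρ g v - v := by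
  rw [QuotientAddGroup.eq_zero_iff, AddSubgroup.mem_addSubgroupOf, AddMonoidHom.mem_range]
  exact exists_congr fun v => eq_comm.trans funext_iff

/-- A surjection from the 1-cocycles whose kernel is the 1-coboundaries identifies `H¹`. -/
noncomputable def H1Equiv (ρ : Representation R G V) (f : cocycles1 ρ →+ X)
    (hs : Function.Surjective f) (hf : ∀ c, f c = 0 ↔ ∃ v, ∀ g, c.1 g = ρ g v - v) :
    H1 ρ ≃+ X :=
  (QuotientAddGroup.quotientAddEquivOfEq (by
    ext c
    rw [AddMonoidHom.mem_ker, hf, ← H1_mk_eq_zero, QuotientAddGroup.eq_zero_iff])).trans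
      (QuotientAddGroup.quotientKerEquivOfSurjective f hs)

/-- `H¹` of isomorphic representations. -/
noncomputable def H1Congr {ρ : Representation R G V} {τ : Representation R G W} (e : ρ.Equiv τ) :
    H1 ρ ≃+ H1 τ :=
  have he : ∀ g v, e (ρ g v) = τ g (e v) := fun g v =>
    Representation.IntertwiningMap.isIntertwining ρ τ e.toIntertwiningMap g v
  let l : V ≃ₗ[R] W := e.toLinearEquiv
  H1Equiv ρ ((QuotientAddGroup.mk' _).comp
    { toFun := fun c => ⟨fun g => l (c.1 g), fun g h => by
        change l (c.1 (g * h)) = l (c.1 g) + τ g (l (c.1 h))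
        rw [c.2 g h, map_add]
        exact congrArg _ (he g _)⟩
      map_zero' := Subtype.ext (funext fun g => map_zero l)
      map_add' := fun c d => Subtype.ext (funext fun g => map_add l _ _) })
    (fun x => by
      obtain ⟨d, rfl⟩ := QuotientAddGroup.mk_surjective x
      refine ⟨⟨fun g => l.symm (d.1 g), fun g h => l.injective ?_⟩, ?_⟩
      · have : l (ρ g (l.symm (d.1 h))) = τ g (d.1 h) := by
          rw [← l.apply_symm_apply (d.1 h), l.symm_apply_apply]
          exact he g _
        rw [map_add, l.apply_symm_apply, l.apply_symm_apply, d.2 g h, this]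
      · exact congrArg (QuotientAddGroup.mk' _)
          (Subtype.ext (funext fun g => l.apply_symm_apply (d.1 g))))
    (fun c => by
      refine (H1_mk_eq_zero τ _).trans ⟨?_, ?_⟩
      · rintro ⟨w, hw⟩
        refine ⟨l.symm w, fun g => l.injective ?_⟩
        have : l (ρ g (l.symm w)) = τ g w := by
          rw [← l.apply_symm_apply w, l.symm_apply_apply]
          exact he g _
        rw [map_sub, this, l.apply_symm_apply]
        exact hw g
      · rintro ⟨v, hv⟩
        refine ⟨l v, fun g => ?_⟩
        change l (c.1 g) = _
        rw [hv, map_sub]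
        exact congrArg (· - l v) (he g v))

/-- A map from a group to a subgroup that is equivariant for left multiplication. -/
theorem exists_equivariant_retraction (N : Subgroup G) :
    ∃ s : G → N, ∀ (h : N) g, s (h * g) = h * s g := by
  let r : G → G := fun g => (Quotient.mk (QuotientGroup.rightRel N) g).out
  have hr : ∀ g, g * (r g)⁻¹ ∈ N := fun g => by
    have := Quotient.mk_out (s := QuotientGroup.rightRel N) g
    exact QuotientGroup.rightRel_apply.mp this
  refine ⟨fun g => ⟨g * (r g)⁻¹, hr g⟩, fun h g => Subtype.ext ?_⟩
  have : r (h * g) = r g := by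
    refine congrArg Quotient.out (Quotient.sound ?_)
    change (QuotientGroup.rightRel N) _ _
    rw [QuotientGroup.rightRel_apply]
    simp
  simp [this, mul_assoc]

/-- Shapiro's lemma in degree one. -/
noncomputable def H1CoindEquiv (N : Subgroup G) (ρ : Representation R N V) :
    H1 (Representation.coind N.subtype ρ) ≃+ H1 ρ :=
  -- Restrict a cocycle to `N` and evaluate its values at 1.
  H1Equiv _ ((QuotientAddGroup.mk' _).comp
    { toFun := fun c => ⟨fun h => (c.1 h).1 1, fun g h => by
        have h1 := congrFun (congrArg Subtype.val (c.2 g h)) 1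
        have h2 := (c.1 h).2 g 1
        refine h1.trans (congrArg ((c.1 g).1 1 + ·) (Eq.trans ?_ h2))
        change (c.1 h).1 (1 * (g : G)) = (c.1 h).1 (g * 1)
        rw [one_mul, mul_one]⟩
      map_zero' := rfl
      map_add' := fun _ _ => rfl })
    (fun x => by
      obtain ⟨b, rfl⟩ := QuotientAddGroup.mk_surjective x
      obtain ⟨s, hs⟩ := exists_equivariant_retraction N
      have hF : ∀ (h : N) g, b.1 (s (h * g)) = b.1 h + ρ h (b.1 (s g)) := fun h g => by
        rw [hs, b.2]
      -- The formal coboundary of `b ∘ s`. This function need not lie in the coinduced module, but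
      -- by `hF` its translates differ from it by elements that do.
      refine ⟨⟨fun g => ⟨fun x => b.1 (s (x * g)) - b.1 (s x), fun h x => ?_⟩, fun g h => ?_⟩, ?_⟩
      · change b.1 (s (h * x * g)) - b.1 (s (h * x)) = _
        rw [mul_assoc, hF, hF, map_sub]
        abel
      · refine Subtype.ext (funext fun x => ?_)
        change b.1 (s (x * (g * h))) - b.1 (s x) = (b.1 (s (x * g)) - b.1 (s x)) +
          (b.1 (s (x * g * h)) - b.1 (s (x * g)))
        rw [mul_assoc]
        abel
      · rw [← sub_eq_zero]
        refine (H1_mk_eq_zero ρ (_ - b)).mpr ⟨b.1 (s 1), fun h => ?_⟩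
        change b.1 (s (1 * (h : G))) - b.1 (s 1) - b.1 h = _
        have := hF h 1
        rw [mul_one] at this
        rw [one_mul, this]
        abel)
    (fun c => by
      refine (H1_mk_eq_zero ρ _).trans ⟨?_, ?_⟩
      · rintro ⟨v, hv⟩
        replace hv : ∀ h : N, (c.1 h).1 1 = ρ h v - v := hv
        have hc : ∀ g g' x, (c.1 (g * g')).1 x = (c.1 g).1 x + (c.1 g').1 (x * g) :=
          fun g g' x => congrFun (congrArg Subtype.val (c.2 g g')) x
        have hN : ∀ g (h : N) x, (c.1 g).1 (h * x) = ρ h ((c.1 g).1 x) :=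
          fun g h x => (c.1 g).2 h x
        -- The cocycle identity at 1 forces this primitive up to its value at 1; the choice `v`
        -- makes it `N`-equivariant.
        refine ⟨⟨fun g => v + (c.1 g).1 1, fun h g => ?_⟩, fun g =>
          Subtype.ext (funext fun x => ?_)⟩
        · change v + (c.1 (h * g)).1 1 = ρ h (v + (c.1 g).1 1)
          have := hN g h 1
          rw [mul_one] at this
          rw [hc, one_mul, this, hv, map_add]
          abel
        · change (c.1 g).1 x = (v + (c.1 (x * g)).1 1) - (v + (c.1 x).1 1)
          rw [hc, one_mul]
          abel
      · rintro ⟨f, hf⟩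
        refine ⟨f.1 1, fun h => ?_⟩
        change (c.1 h).1 1 = _
        rw [hf h]
        change f.1 (1 * (h : G)) - f.1 1 = _
        have := f.2 h 1
        rw [one_mul, ← this]
        simp)

end FirstCohomology

/-! ### Units twisted by a sign character, and Hilbert 90. -/

section TwistedUnits

variable {k K : Type*} [Field k] [Field K] [Algebra k K] {N : Subgroup (K ≃ₐ[k] K)}

theorem integer_apply {H : Type*} [Group H] (U : Representation ℤ H ℤ) (h : H) (z : ℤ) :
    U h z = z * U h 1 := by
  have := (U h).map_smul z 1
  simpa using this

/-- So `h ↦ U h 1` is a character with values `±1`; it determines `U`, and the canonical subgroup is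
its kernel. -/
theorem integer_mul {H : Type*} [Group H] (U : Representation ℤ H ℤ) (g h : H) :
    U (g * h) 1 = U g 1 * U h 1 := by
  rw [map_mul, Module.End.mul_apply, integer_apply, mul_comm]

theorem integer_eq_one_or {H : Type*} [Group H] (U : Representation ℤ H ℤ) (h : H) :
    U h 1 = 1 ∨ U h 1 = -1 := by
  have h1 : U h 1 * U h⁻¹ 1 = 1 := by rw [← integer_mul, mul_inv_cancel]; simp
  exact Int.eq_one_or_neg_one_of_mul_eq_one h1

/-- The multiplicative group with the Galois action twisted by the character of an integer. -/
noncomputable def twistedUnitsRep (N : Subgroup (K ≃ₐ[k] K)) (U : Representation ℤ N ℤ) :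
    Representation ℤ N (Additive Kˣ) where
  toFun h := U h 1 • unitsRep k K h
  map_one' := by simp
  map_mul' g h := by
    rw [integer_mul, Subgroup.coe_mul, map_mul, smul_mul_smul_comm]

theorem twistedUnitsRep_apply (U : Representation ℤ N ℤ) (h : N) (x : Additive Kˣ) :
    twistedUnitsRep N U h x = U h 1 • unitsRep k K h x := rfl

/-- Tensoring the multiplicative group with an integer twists the action. -/
noncomputable def tensorUnitsEquiv (N : Subgroup (K ≃ₐ[k] K)) (U : Representation ℤ N ℤ) :
    (tensorUnitsRep N U).Equiv (twistedUnitsRep N U) :=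
  .mk (TensorProduct.lid ℤ (Additive Kˣ)) fun h => TensorProduct.ext' fun z x => by
    change TensorProduct.lid ℤ _ (U h z ⊗ₜ unitsRep k K h x) =
      U h 1 • unitsRep k K h (TensorProduct.lid ℤ _ (z ⊗ₜ x))
    rw [TensorProduct.lid_tmul, TensorProduct.lid_tmul, integer_apply, map_zsmul, smul_smul,
      mul_comm]

/-- Hilbert's theorem 90 for a subgroup of the Galois group. -/
theorem exists_smul_div_of_cocycle [FiniteDimensional k K] (S : Subgroup (K ≃ₐ[k] K))
    (c : S → Kˣ) (hc : ∀ g h, c (g * h) = c g * (g : K ≃ₐ[k] K) • c h) :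
    ∃ b : Kˣ, ∀ g : S, c g = (g : K ≃ₐ[k] K) • b / b := by
  let e := IntermediateField.subgroupEquivAlgEquiv S
  have he : ∀ g (x : Kˣ), g • x = (e.symm g : K ≃ₐ[k] K) • x := fun g x => by
    obtain ⟨s, rfl⟩ := e.surjective g
    rw [e.symm_apply_apply]
    rfl
  obtain ⟨b, hb⟩ := groupCohomology.isMulCoboundary₁_of_isMulCocycle₁_of_aut_to_units
    (fun g => c (e.symm g)) fun g h => by
      change c (e.symm (g * h)) = g • c (e.symm h) * c (e.symm g)
      rw [map_mul, hc, he, mul_comm]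
  refine ⟨b, fun s => ?_⟩
  have := hb (e s)
  rw [he, e.symm_apply_apply] at this
  exact this.symm

/-- A twisted cocycle is a coboundary on the canonical subgroup. -/
theorem exists_coboundary_on_canonicalSubgroup [FiniteDimensional k K]
    (U : Representation ℤ N ℤ) (c : cocycles1 (twistedUnitsRep N U)) :
    ∃ b, ∀ h ∈ canonicalSubgroup U, c.1 h = twistedUnitsRep N U h b - b := by
  let S := (canonicalSubgroup U).map N.subtype
  have hS : S ≤ N := Subgroup.map_subtype_le _
  have hSU : ∀ s : S, (⟨s, hS s.2⟩ : N) ∈ canonicalSubgroup U := by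
    rintro ⟨_, h, hh, rfl⟩
    exact hh
  -- The twist is trivial on the canonical subgroup, so the restricted cocycle is an ordinary one.
  obtain ⟨b, hb⟩ := exists_smul_div_of_cocycle S (fun s => (c.1 ⟨s, hS s.2⟩).toMul) fun g h => by
    have h1 := c.2 ⟨g, hS g.2⟩ ⟨h, hS h.2⟩
    have h2 : U ⟨g, hS g.2⟩ 1 = 1 := hSU g
    rw [twistedUnitsRep_apply, h2, one_smul] at h1
    exact congrArg Additive.toMul h1
  refine ⟨Additive.ofMul b, fun h hh => ?_⟩
  have h1 := hb ⟨h, h, hh, rfl⟩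
  have h2 : U h 1 = 1 := hh
  rw [twistedUnitsRep_apply, h2, one_smul]
  exact congrArg Additive.ofMul h1

theorem H1_twistedUnitsRep_subsingleton [FiniteDimensional k K] (U : Representation ℤ N ℤ)
    (hU : canonicalSubgroup U = ⊤) : Subsingleton (H1 (twistedUnitsRep N U)) := by
  refine subsingleton_of_forall_eq 0 fun x => ?_
  obtain ⟨c, rfl⟩ := QuotientAddGroup.mk_surjective x
  obtain ⟨b, hb⟩ := exists_coboundary_on_canonicalSubgroup U c
  exact (H1_mk_eq_zero _ c).mpr ⟨b, fun h => hb h (hU ▸ Subgroup.mem_top h)⟩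

end TwistedUnits

/-! ### H¹ of the twisted units as units modulo norms. -/

section QuadraticCohomology

variable {k K : Type*} [Field k] [Field K] [Algebra k K] {N : Subgroup (K ≃ₐ[k] K)}
  {U : Representation ℤ N ℤ}

theorem mem_fixedFieldOver {x : K} :
    x ∈ fixedFieldOver N (canonicalSubgroup U) ↔
      ∀ h ∈ canonicalSubgroup U, (h : K ≃ₐ[k] K) x = x := by
  refine (IntermediateField.mem_extendScalars _).trans
    ((IntermediateField.mem_fixedField_iff _ x).trans ?_)
  constructor
  · exact fun hx h hh => hx h ⟨h, hh, rfl⟩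
  · rintro hx _ ⟨h, hh, rfl⟩
    exact hx h hh

theorem conj_mem_canonicalSubgroup {h : N} (hh : h ∈ canonicalSubgroup U) (t : N) :
    t⁻¹ * h * t ∈ canonicalSubgroup U := by
  have h1 : U h 1 = 1 := hh
  have h2 : U t⁻¹ 1 * U t 1 = 1 := by rw [← integer_mul, inv_mul_cancel]; simp
  change U (t⁻¹ * h * t) 1 = 1
  rw [integer_mul, integer_mul, h1, mul_one, h2]

theorem mul_mem_canonicalSubgroup_of_notMem {s t : N} (hs : s ∉ canonicalSubgroup U)
    (ht : t ∉ canonicalSubgroup U) : s * t ∈ canonicalSubgroup U := by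
  have h1 : U s 1 = -1 := (integer_eq_one_or U s).resolve_left hs
  have h2 : U t 1 = -1 := (integer_eq_one_or U t).resolve_left ht
  change U (s * t) 1 = 1
  rw [integer_mul, h1, h2]
  rfl

/-- The restriction of an element of `N` to the fixed field of the canonical subgroup. -/
def restrictFixed (U : Representation ℤ N ℤ) (t : N) :
    fixedFieldOver N (canonicalSubgroup U) →ₐ[IntermediateField.fixedField N]
      fixedFieldOver N (canonicalSubgroup U) where
  toFun x := ⟨(t : K ≃ₐ[k] K) x, mem_fixedFieldOver.mpr fun h hh => by
    have h1 := mem_fixedFieldOver.mp x.2 _ (conj_mem_canonicalSubgroup hh t)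
    have h2 := congrArg (t : K ≃ₐ[k] K) h1
    rw [← AlgEquiv.mul_apply] at h2
    rw [← AlgEquiv.mul_apply]
    simpa [mul_assoc] using h2⟩
  map_one' := Subtype.ext (map_one _)
  map_mul' x y := Subtype.ext (map_mul _ _ _)
  map_zero' := Subtype.ext (map_zero _)
  map_add' x y := Subtype.ext (map_add _ _ _)
  commutes' x := Subtype.ext ((IntermediateField.mem_fixedField_iff _ _).mp x.2 t t.2)

/-- For `h` outside the canonical subgroup, `h * t` lies in it, so `h x = h (t x) = x`. -/
theorem mem_fixedField_of_fixed {t : N} (ht : t ∉ canonicalSubgroup U) {x : K}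
    (hx : x ∈ fixedFieldOver N (canonicalSubgroup U)) (htx : (t : K ≃ₐ[k] K) x = x) :
    x ∈ IntermediateField.fixedField N := by
  rw [IntermediateField.mem_fixedField_iff]
  intro h hN
  by_cases hh : (⟨h, hN⟩ : N) ∈ canonicalSubgroup U
  · exact mem_fixedFieldOver.mp hx _ hh
  · have h1 := mem_fixedFieldOver.mp hx _ (mul_mem_canonicalSubgroup_of_notMem hh ht)
    rw [Subgroup.coe_mul, AlgEquiv.mul_apply, htx] at h1
    exact h1

theorem isConjugation_restrictFixed [FiniteDimensional k K] {t : N}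
    (ht : t ∉ canonicalSubgroup U) : IsConjugation (restrictFixed U t) where
  involutive x := Subtype.ext
    (mem_fixedFieldOver.mp x.2 _ (mul_mem_canonicalSubgroup_of_notMem ht ht))
  fixed x hx := ⟨⟨x, mem_fixedField_of_fixed ht x.2 (congrArg Subtype.val hx)⟩, rfl⟩
  exists_ne := by
    by_contra! hcon
    -- If `t` acted trivially on the fixed field, the Galois correspondence would put it in the
    -- canonical subgroup.
    have h1 : (t : K ≃ₐ[k] K) ∈ IntermediateField.fixingSubgroup
        (IntermediateField.fixedField ((canonicalSubgroup U).map N.subtype)) := by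
      rw [IntermediateField.mem_fixingSubgroup_iff]
      intro x hx
      exact congrArg Subtype.val
        (hcon ⟨x, (IntermediateField.mem_extendScalars _).mpr hx⟩)
    rw [IntermediateField.fixingSubgroup_fixedField] at h1
    obtain ⟨h, hh, hht⟩ := h1
    exact ht (Subtype.ext hht ▸ hh)

/-- The inclusion of the units of the fixed field of `N`. -/
noncomputable def fixedUnit (N : Subgroup (K ≃ₐ[k] K)) :
    (IntermediateField.fixedField N)ˣ →* Kˣ :=
  Units.map (algebraMap (IntermediateField.fixedField N) K).toMonoidHom

theorem unitsRep_fixedUnit (g : N) (a : (IntermediateField.fixedField N)ˣ) :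
    unitsRep k K g (Additive.ofMul (fixedUnit N a)) = Additive.ofMul (fixedUnit N a) :=
  congrArg Additive.ofMul (Units.ext ((IntermediateField.mem_fixedField_iff _ _).mp a.1.2 g g.2))

open scoped Classical in
/-- The twisted cocycle that vanishes on the canonical subgroup and is `a` elsewhere. -/
noncomputable def unitCocycle (U : Representation ℤ N ℤ) :
    (IntermediateField.fixedField N)ˣ →*
      Multiplicative (cocycles1 (twistedUnitsRep N U)) where
  toFun a := Multiplicative.ofAdd ⟨fun h => if h ∈ canonicalSubgroup U then 0 else
    Additive.ofMul (fixedUnit N a), by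
      intro g h
      have ha := unitsRep_fixedUnit g a
      by_cases hg : g ∈ canonicalSubgroup U
      · have hg1 : U g 1 = 1 := hg
        have hgh : g * h ∈ canonicalSubgroup U ↔ h ∈ canonicalSubgroup U :=
          Subgroup.mul_mem_cancel_left _ hg
        by_cases hh : h ∈ canonicalSubgroup U <;>
          simp [hg, hh, hgh, twistedUnitsRep_apply, hg1, ha]
      · have hg1 : U g 1 = -1 := (integer_eq_one_or U g).resolve_left hg
        by_cases hh : h ∈ canonicalSubgroup U
        · have hgh : g * h ∉ canonicalSubgroup U := fun h1 =>
            hg ((Subgroup.mul_mem_cancel_right _ hh).mp h1)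
          simp [hg, hh, hgh]
        · simp [hg, hh, mul_mem_canonicalSubgroup_of_notMem hg hh, twistedUnitsRep_apply, hg1, ha]⟩
  map_one' := Multiplicative.toAdd.injective (Subtype.ext (funext fun h => by simp))
  map_mul' a b := Multiplicative.toAdd.injective (Subtype.ext (funext fun h => by
    by_cases hh : h ∈ canonicalSubgroup U <;> simp [hh]))

theorem unitCocycle_apply_of_mem (a : (IntermediateField.fixedField N)ˣ) {h : N}
    (hh : h ∈ canonicalSubgroup U) : (unitCocycle U a).toAdd.1 h = 0 := if_pos hh

theorem unitCocycle_apply_of_notMem (a : (IntermediateField.fixedField N)ˣ) {h : N}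
    (hh : h ∉ canonicalSubgroup U) : (unitCocycle U a).toAdd.1 h =
      Additive.ofMul (fixedUnit N a) := if_neg hh

/-- The class of `unitCocycle`. -/
noncomputable def unitClass (U : Representation ℤ N ℤ) :
    (IntermediateField.fixedField N)ˣ →* Multiplicative (H1 (twistedUnitsRep N U)) :=
  (AddMonoidHom.toMultiplicative (QuotientAddGroup.mk' _)).comp (unitCocycle U)

/-- Subtracting a coboundary makes the cocycle vanish on the canonical subgroup; it is then constant
on the other coset, and its value is fixed by all of `N`. -/
theorem unitClass_surjective [FiniteDimensional k K] {t : N} (ht : t ∉ canonicalSubgroup U) :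
    Function.Surjective (unitClass U) := by
  intro x
  obtain ⟨c, hc⟩ := QuotientAddGroup.mk_surjective x.toAdd
  obtain ⟨b, hb⟩ := exists_coboundary_on_canonicalSubgroup U c
  let d : cocycles1 (twistedUnitsRep N U) := ⟨fun h => c.1 h - (twistedUnitsRep N U h b - b),
    fun g h => by
      simp only [c.2 g h, map_mul, Module.End.mul_apply, map_sub]
      abel⟩
  have hd : ∀ h ∈ canonicalSubgroup U, d.1 h = 0 := fun h hh => sub_eq_zero.mpr (hb h hh)
  have hd' : ∀ s, s ∉ canonicalSubgroup U → d.1 s = d.1 t := fun s hs => by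
    have h1 : t⁻¹ * s ∈ canonicalSubgroup U :=
      mul_mem_canonicalSubgroup_of_notMem (fun h => ht (inv_mem_iff.mp h)) hs
    have h2 := d.2 t (t⁻¹ * s)
    rw [mul_inv_cancel_left, hd _ h1, map_zero, add_zero] at h2
    exact h2
  have ht1 : U t 1 = -1 := (integer_eq_one_or U t).resolve_left ht
  have hfixI : ∀ h ∈ canonicalSubgroup U, unitsRep k K h (d.1 t) = d.1 t := fun h hh => by
    have h1 : U h 1 = 1 := hh
    have h2 := d.2 h t
    rw [hd h hh, zero_add, twistedUnitsRep_apply, h1, one_smul,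
      hd' _ fun h3 => ht ((Subgroup.mul_mem_cancel_left _ hh).mp h3)] at h2
    exact h2.symm
  -- As `t * t` is in the canonical subgroup and `t` has sign `-1`, the cocycle identity reads `0 =
  -- d t - t (d t)`.
  have hfixt : unitsRep k K t (d.1 t) = d.1 t := by
    have h2 := d.2 t t
    rw [hd _ (mul_mem_canonicalSubgroup_of_notMem ht ht), twistedUnitsRep_apply, ht1, neg_one_smul,
      ← sub_eq_add_neg] at h2
    exact (sub_eq_zero.mp h2.symm).symm
  let u : Kˣ := (d.1 t).toMul
  have hu : (u : K) ∈ IntermediateField.fixedField N :=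
    mem_fixedField_of_fixed ht
      (mem_fixedFieldOver.mpr fun h hh => congrArg (fun z : Additive Kˣ => (z.toMul : K))
        (hfixI h hh))
      (congrArg (fun z : Additive Kˣ => (z.toMul : K)) hfixt)
  let a : (IntermediateField.fixedField N)ˣ :=
    Units.mk0 ⟨u, hu⟩ fun h => u.ne_zero (congrArg Subtype.val h)
  have hac : (unitCocycle U a).toAdd = d := by
    refine Subtype.ext (funext fun h => ?_)
    by_cases hh : h ∈ canonicalSubgroup U
    · rw [unitCocycle_apply_of_mem a hh, hd h hh]
    · rw [unitCocycle_apply_of_notMem a hh, hd' h hh]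
      exact congrArg Additive.ofMul (Units.ext rfl)
  refine ⟨a, Multiplicative.toAdd.injective ?_⟩
  change (((unitCocycle U a).toAdd : cocycles1 _) : H1 (twistedUnitsRep N U)) = x.toAdd
  rw [hac, ← hc, ← sub_eq_zero, ← QuotientAddGroup.mk_sub]
  refine (H1_mk_eq_zero _ _).mpr ⟨-b, fun h => ?_⟩
  change c.1 h - (twistedUnitsRep N U h b - b) - c.1 h = _
  rw [map_neg]
  abel

/-- A primitive `v` is fixed by the canonical subgroup, hence is a unit `u` of its fixed field. The
sign `-1` at `t` gives `a = t(u)⁻¹ / u`, the norm of `u⁻¹`; this explains the inverses in both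
directions. -/
theorem unitClass_eq_one_iff {t : N} (ht : t ∉ canonicalSubgroup U)
    (a : (IntermediateField.fixedField N)ˣ) :
    unitClass U a = 1 ↔ a ∈ normUnits (restrictFixed U t) := by
  have h0 : unitClass U a = 1 ↔ ∃ v, ∀ h, (unitCocycle U a).toAdd.1 h =
      twistedUnitsRep N U h v - v := H1_mk_eq_zero _ _
  have ht1 : U t 1 = -1 := (integer_eq_one_or U t).resolve_left ht
  rw [h0]
  constructor
  · rintro ⟨v, hv⟩
    let u : Kˣ := v.toMul
    have hu : (u : K) ∈ fixedFieldOver N (canonicalSubgroup U) :=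
      mem_fixedFieldOver.mpr fun h hh => by
        have h1 : U h 1 = 1 := hh
        have h2 := hv h
        rw [unitCocycle_apply_of_mem a hh, twistedUnitsRep_apply, h1, one_smul] at h2
        exact congrArg (fun z : Additive Kˣ => (z.toMul : K)) (sub_eq_zero.mp h2.symm)
    have h3 := hv t
    rw [unitCocycle_apply_of_notMem a ht, twistedUnitsRep_apply, ht1, neg_one_smul] at h3
    have h4 := congrArg (fun z : Additive Kˣ => (z.toMul : K)) h3
    have h5 : (algebraMap (IntermediateField.fixedField N) K a : K) =
        ((t : K ≃ₐ[k] K) u)⁻¹ / u := by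
      refine h4.trans ?_
      rw [toMul_sub, Units.val_div_eq_div_val, toMul_neg, Units.val_inv_eq_inv_val]
      rfl
    let c : (fixedFieldOver N (canonicalSubgroup U))ˣ :=
      Units.mk0 ⟨u, hu⟩ fun h => u.ne_zero (congrArg Subtype.val h)
    refine ⟨c⁻¹, Subtype.ext ?_⟩
    refine h5.trans ?_
    rw [Units.val_inv_eq_inv_val, map_inv₀]
    change _ = (u : K)⁻¹ * ((t : K ≃ₐ[k] K) u)⁻¹
    rw [div_eq_mul_inv, mul_comm]
  · rintro ⟨c, hc⟩
    have hc' : (algebraMap (IntermediateField.fixedField N) K a : K) =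
        (c : fixedFieldOver N (canonicalSubgroup U)) *
          (t : K ≃ₐ[k] K) (c : fixedFieldOver N (canonicalSubgroup U)) := congrArg Subtype.val hc
    let u : Kˣ := Units.map (fixedFieldOver N (canonicalSubgroup U)).val.toMonoidHom c
    have hI : ∀ h ∈ canonicalSubgroup U,
        unitsRep k K h (Additive.ofMul u) = Additive.ofMul u := fun h hh =>
      congrArg Additive.ofMul (Units.ext (mem_fixedFieldOver.mp c.1.2 h hh))
    have ht' : ∀ h ∉ canonicalSubgroup U,
        unitsRep k K h (Additive.ofMul u) = unitsRep k K t (Additive.ofMul u) := fun h hh => by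
      have h1 : t⁻¹ * h ∈ canonicalSubgroup U :=
        mul_mem_canonicalSubgroup_of_notMem (fun h => ht (inv_mem_iff.mp h)) hh
      rw [← mul_inv_cancel_left t h, Subgroup.coe_mul, map_mul, Module.End.mul_apply, hI _ h1]
    have hau : Additive.ofMul (fixedUnit N a) =
        Additive.ofMul u + unitsRep k K t (Additive.ofMul u) :=
      congrArg Additive.ofMul (Units.ext hc')
    refine ⟨-Additive.ofMul u, fun h => ?_⟩
    by_cases hh : h ∈ canonicalSubgroup U
    · have h1 : U h 1 = 1 := hh
      rw [unitCocycle_apply_of_mem a hh, twistedUnitsRep_apply, h1, one_smul, map_neg, hI h hh,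
        sub_self]
    · have h1 : U h 1 = -1 := (integer_eq_one_or U h).resolve_left hh
      rw [unitCocycle_apply_of_notMem a hh, twistedUnitsRep_apply, h1, neg_one_smul, map_neg,
        ht' h hh, neg_neg, sub_neg_eq_add, add_comm, hau]

/-- A surjection onto an additive group identifies it with the quotient by the kernel. -/
noncomputable def quotientEquivOfSurjective {Q A : Type*} [CommGroup Q] [AddCommGroup A]
    (f : Q →* Multiplicative A) (hf : Function.Surjective f) (S : Subgroup Q)
    (hS : ∀ a, f a = 1 ↔ a ∈ S) : A ≃+ Additive (Q ⧸ S) :=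
  have hker : S = f.ker := by
    ext a
    exact (hS a).symm
  (MulEquiv.toAdditiveLeft ((QuotientGroup.quotientMulEquivOfEq hker).trans
    (QuotientGroup.quotientKerEquivOfSurjective f hf))).symm

/-- `H¹` of the twisted units when the canonical subgroup is proper. -/
noncomputable def H1TwistedEquiv [FiniteDimensional k K] {t : N} (ht : t ∉ canonicalSubgroup U) :
    H1 (twistedUnitsRep N U) ≃+
      Additive ((IntermediateField.fixedField N)ˣ ⧸ normUnits (restrictFixed U t)) :=
  quotientEquivOfSurjective (unitClass U) (unitClass_surjective ht) _ (unitClass_eq_one_iff ht)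

theorem nonempty_H1_twisted_equiv [FiniteDimensional k K] :
    Nonempty (H1 (twistedUnitsRep N U) ≃+ Additive (relBrauerGroup (IntermediateField.fixedField N)
      (fixedFieldOver N (canonicalSubgroup U)))) := by
  by_cases hU : canonicalSubgroup U = ⊤
  · have h1 := H1_twistedUnitsRep_subsingleton U hU
    have h2 : Subsingleton (relBrauerGroup (IntermediateField.fixedField N)
        (fixedFieldOver N (canonicalSubgroup U))) := relBrauerGroup_subsingleton fun x =>
      ⟨⟨x, (IntermediateField.mem_fixedField_iff _ _).mpr fun h hh =>
        mem_fixedFieldOver.mp x.2 ⟨h, hh⟩ (hU ▸ Subgroup.mem_top _)⟩, rfl⟩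
    exact ⟨{ toFun := fun _ => 0, invFun := fun _ => 0, left_inv := fun _ => Subsingleton.elim _ _,
             right_inv := fun x => Subsingleton.elim (α := relBrauerGroup _ _) _ _,
             map_add' := fun _ _ => (add_zero 0).symm }⟩
  · obtain ⟨t, ht⟩ : ∃ t, t ∉ canonicalSubgroup U := by
      by_contra! hcon
      exact hU (eq_top_iff.mpr fun t _ => hcon t)
    exact ⟨(H1TwistedEquiv ht).trans
      (MulEquiv.toAdditive (relBrauerEquiv (isConjugation_restrictFixed ht)).symm)⟩

end QuadraticCohomology

end TorusForms

theorem theorem3p6 {k K : Type*} [Field k] [Field K] [Algebra k K] [FiniteDimensional k K]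
    [IsGalois k K] {n m : ℕ} (φ : (K ≃ₐ[k] K) →* GL (Fin n) ℤ)
    (g : Fin m → (K ≃ₐ[k] K)) (hg : Subgroup.closure (Set.range g) = ⊤)
    (N : Subgroup (K ≃ₐ[k] K)) (U : Representation ℤ N ℤ)
    (hsim : TorusForms.SimilarToOperators
      (fun i => (φ (g i) : Matrix (Fin n) (Fin n) ℤ))
      (fun i => TorusForms.indOperator N U (g i))) :
    Nonempty ((TorusForms.torusRep φ).Equiv
      (Representation.ind N.subtype (TorusForms.tensorUnitsRep N U))) ∧
    Nonempty (TorusForms.H1 (TorusForms.torusRep φ) ≃+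
      Additive (TorusForms.relBrauerGroup (IntermediateField.fixedField N)
        (TorusForms.fixedFieldOver N (TorusForms.canonicalSubgroup U)))) := by
  obtain ⟨e₁⟩ := TorusForms.SimilarToOperators.nonempty_torusEquiv hg hsim
  let e := e₁.trans (TorusForms.indTensorEquiv N.subtype U (TorusForms.unitsRep k K))
  obtain ⟨b⟩ := TorusForms.nonempty_H1_twisted_equiv (U := U)
  exact ⟨⟨e⟩, ⟨(TorusForms.H1Congr e).trans
    ((TorusForms.H1Congr (TorusForms.indEquivCoind N _)).trans
      ((TorusForms.H1CoindEquiv N _).trans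
        ((TorusForms.H1Congr (TorusForms.tensorUnitsEquiv N U)).trans b)))⟩⟩
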